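/- Let $n\ge 0$. A subset $G\subset\mathbb{R}^3$ is ambient isotopic to $G'\subset\mathbb R^3$ if there is a continuous map $F:[0,1]\times\mathbb{R}^3\to\mathbb{R}^3$ such that every $F_t=F(t,\cdot)$ is a homeomorphism of $\mathbb R^3$, $F_0=\mathrm{id}$ and $F_1(G)=G'$. The set $G$ is achiral if it is ambient isotopic to its mirror image (under reflection in a plane), and chiral otherwise. The Hopf ladder $H_n$ is the spatial graph, considered up to ambient isotopy, that is obtained from a Hopf link, drawn as two round circles with two crossings, by adding $n$ pairs of vertices $(v^1_1,v^2_1),\dots,(v^1_n,v^2_n)$, with $v^1_1,\dots,v^1_n$ distinct points on one component and $v^2_1,\dots,v^2_n$ distinct points on the other, in the same cyclic order up to reversal, and $n$ edges (rungs) $e_1,\dots,e_n$, where $e_i$ joins $v^1_i$ to $v^2_i$, such that the rungs add no crossings to the diagram. Explicitly, $H_n$ (with either handedness) is any subset of $\mathbb R^3$ that is ambient isotopic to the following set or to its mirror image: the union of the circles $a(\alpha)=(-\cos\alpha,\sin\alpha,0)$ and $b(\alpha)=(1-\cos\alpha,0,\sin\alpha)$, $\alpha\in\mathbb R$, and of the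 straight segments from $a(\alpha_k)$ to $b(\alpha_k)$, where $\alpha_k=k\pi+\lfloor k/2\rfloor/n$ for $0\le k<n$. Then $H_n$ is achiral if $0\le n\le 2$ and chiral if $n\ge 3$. -/

import Mathlib

/-- Euclidean three-space. -/
abbrev Space3 : Type := EuclideanSpace ℝ (Fin 3)

/-- Two subsets of `ℝ³` are ambient isotopic: there is a continuous family `F t`, `t ∈ [0,1]`, of
homeomorphisms of `ℝ³` that starts at the identity and whose end `F 1` maps `G` onto `G'`. -/
def AmbientIsotopic (G G' : Set Space3) : Prop :=
  ∃ F : unitInterval × Space3 → Space3,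
    Continuous F ∧
    (∀ t, IsHomeomorph fun x => F (t, x)) ∧
    (∀ x, F (0, x) = x) ∧
    (fun x => F (1, x)) '' G = G'

/-- The mirror image of a subset of `ℝ³`, under reflection in the plane `z = 0`. -/
def mirrorImage (G : Set Space3) : Set Space3 :=
  (fun x : Space3 => (!₂[x 0, x 1, -x 2] : Space3)) '' G

/-- Achirality: ambient isotopic to the mirror image. -/
def IsAchiral (G : Set Space3) : Prop := AmbientIsotopic G (mirrorImage G)

/-- Chirality: not ambient isotopic to the mirror image. -/
def IsChiral (G : Set Space3) : Prop := ¬ AmbientIsotopic G (mirrorImage G)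

namespace HopfLadder

/-- The first component of the Hopf link: the unit circle about the origin in the plane `z = 0`. -/
noncomputable def side₁ (α : ℝ) : Space3 := !₂[-Real.cos α, Real.sin α, 0]

/-- The second component of the Hopf link: the unit circle about `(1, 0, 0)` in the plane
`y = 0`. -/
noncomputable def side₂ (α : ℝ) : Space3 := !₂[1 - Real.cos α, 0, Real.sin α]

/-- The parameter of the end points of rung `k`. These parameters are pairwise distinct modulo
`2π`; they lie in `[0, 1/2)` for even `k` and in `[π, π + 1/2)` for odd `k`. -/
noncomputable def rungAngle (n : ℕ) (k : Fin n) : ℝ :=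
  (k : ℕ) * Real.pi + ((k : ℕ) / 2 : ℕ) / (n : ℝ)

/-- Rung `k`: the straight edge that joins the two vertices with parameter `rungAngle n k`. -/
noncomputable def rung (n : ℕ) (k : Fin n) : Set Space3 :=
  segment ℝ (side₁ (rungAngle n k)) (side₂ (rungAngle n k))

/-- The standard Hopf ladder with `n` rungs.

Its diagram under the projection `(x, y, z) ↦ (x, y + z)` consists of the unit circles about `(0, 0)`
and `(1, 0)`, which cross at two points, and of `n` horizontal segments: the segment of parameter
`α` goes from `(-cos α, sin α)` to `(1 - cos α, sin α)`. As `|cos α| > 1/2`, it lies in the left or in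
the right of the two crescents between the circles, so that the rungs meet neither each other nor,
except at their ends, the circles. The end points of the rungs follow each other in the same cyclic
order on both circles, since both ends of a rung have the same parameter. -/
def standard (n : ℕ) : Set Space3 :=
  Set.range side₁ ∪ Set.range side₂ ∪ ⋃ k : Fin n, rung n k

end HopfLadder

/-- A Hopf ladder with `n` rungs is a spatial graph that is ambient isotopic to the standard one, of
either handedness. -/
def IsHopfLadder (n : ℕ) (G : Set Space3) : Prop :=
  AmbientIsotopic (HopfLadder.standard n) G ∨
    AmbientIsotopic (mirrorImage (HopfLadder.standard n)) G

/-! With at most two rungs, all rungs of the standard ladder lie on the `x`-axis, and the ladder is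
literally invariant under the reflection.

For `n ≥ 3` the obstruction is the linking number of the two sides, that is, the degree of `(s, u) ↦
γ s - δ u` from the torus to punctured space. An isotopy preserves it and a reflection changes its
sign. If the ladder were isotopic to its mirror image, following the isotopy by the reflection would
give a homeomorphism `f` of space that maps the ladder onto itself and reverses the linking number
of its sides.

The ladder lies on the Hopf band, an embedded annulus. Two disjoint loops on the band that wind `w`
and `w'` times around it are linked like the sides run through `w` and `w'` times
(`eventually_curvature_eq_of_band`), because one of them can be pushed off the band and both can
then be moved freely. It remains to find `w` and `w'` for the images of the sides. Vertices are the
branch points of the ladder, so `f` permutes them. If `w` and `w'` are nonzero, both images visit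
the vertices in cyclic order, one step at a time, with `w, w' = ±1`; rungs go to rungs, so `n`
divides `w' - w`, and `n ≥ 3` forces `w = w'` (`RungSystem.winding_eq`). Thus `f` either kills the
linking number or keeps it. As that of the Hopf link is not zero, it cannot be reversed.

The degree is taken as the Chern number of the pulled-back spinor line bundle, discretized on an `N
× N` grid: the sum of the arguments of the holonomies of the cells. It lies in `2πℤ` whenever no
holonomy vanishes, and on fine grids it varies continuously along a homotopy, hence is constant. -/

/-! ### The degree of a map from the torus to punctured space, by a discrete Chern number -/

namespace TorusDegree

open Complex Filter Topology ComplexConjugate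

/-- The horizontal coordinates `x`, `z` of a vector as a complex number. -/
noncomputable def planar (v : Space3) : ℂ := ⟨v 0, v 2⟩

/-- Twice the norm of `v` times the projector of `ℂ²` onto the spinor of direction `v`. -/
noncomputable def spinMatrix (v : Space3) : Matrix (Fin 2) (Fin 2) ℂ :=
  !![((‖v‖ + v 1 : ℝ) : ℂ), conj (planar v); planar v, ((‖v‖ - v 1 : ℝ) : ℂ)]

/-- The holonomy of the spinor bundle around a quadrilateral. -/
noncomputable def holonomy (v₁ v₂ v₃ v₄ : Space3) : ℂ :=
  (spinMatrix v₁ * spinMatrix v₂ * spinMatrix v₃ * spinMatrix v₄).trace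

/-- The Hermitian pairing of two spinors. -/
noncomputable def pairing (p q : ℂ × ℂ) : ℂ := conj p.1 * q.1 + conj p.2 * q.2

/-- `p` is a spinor of the vector `v`. -/
structure IsSpinor (p : ℂ × ℂ) (v : Space3) : Prop where
  fst : p.1 * conj p.1 = ((‖v‖ + v 1 : ℝ) : ℂ)
  snd : p.2 * conj p.2 = ((‖v‖ - v 1 : ℝ) : ℂ)
  mixed : p.2 * conj p.1 = planar v

theorem norm_sq_coords (v : Space3) : ‖v‖ ^ 2 = v 0 ^ 2 + v 1 ^ 2 + v 2 ^ 2 := by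
  rw [EuclideanSpace.norm_sq_eq, Fin.sum_univ_three]
  simp [sq_abs]

theorem abs_coord_one_le_norm (v : Space3) : |v 1| ≤ ‖v‖ := by
  apply abs_le_of_sq_le_sq _ (norm_nonneg v)
  rw [norm_sq_coords]
  nlinarith [sq_nonneg (v 0), sq_nonneg (v 2)]

theorem exists_isSpinor (v : Space3) : ∃ p, IsSpinor p v := by
  have h := abs_le.1 (abs_coord_one_le_norm v)
  have hn := norm_sq_coords v
  -- On the ray of nonpositive `y` the first component vanishes and cannot be divided by; no choice
  -- of spinor is continuous in all directions.
  by_cases h0 : ‖v‖ + v 1 = 0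
  · have hx : v 0 = 0 := by nlinarith [sq_nonneg (v 0), sq_nonneg (v 2)]
    have hz : v 2 = 0 := by nlinarith [sq_nonneg (v 0), sq_nonneg (v 2)]
    refine ⟨(0, (Real.sqrt (‖v‖ - v 1) : ℂ)), ?_, ?_, ?_⟩
    · simp [h0]
    · have : 0 ≤ ‖v‖ - v 1 := by linarith
      simp only [conj_ofReal]
      rw [← ofReal_mul, Real.mul_self_sqrt this]
    · apply Complex.ext <;> simp [planar, hx, hz]
  · have hp : 0 < ‖v‖ + v 1 := lt_of_le_of_ne (by linarith) (Ne.symm h0)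
    have hs : Real.sqrt (‖v‖ + v 1) * Real.sqrt (‖v‖ + v 1) = ‖v‖ + v 1 :=
      Real.mul_self_sqrt hp.le
    have hs0 : Real.sqrt (‖v‖ + v 1) ≠ 0 := (Real.sqrt_pos.2 hp).ne'
    refine ⟨((Real.sqrt (‖v‖ + v 1) : ℂ), planar v / (Real.sqrt (‖v‖ + v 1) : ℂ)), ?_, ?_, ?_⟩
    · simp only [conj_ofReal]
      rw [← ofReal_mul, hs]
    · simp only [map_div₀, conj_ofReal]
      rw [div_mul_div_comm, mul_conj, ← ofReal_mul, hs, ← ofReal_div]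
      congr 1
      rw [div_eq_iff hp.ne', normSq_apply]
      simp only [planar]
      nlinarith
    · simp only [conj_ofReal]
      rw [div_mul_cancel₀]
      exact_mod_cast hs0

theorem conj_pairing (p q : ℂ × ℂ) : conj (pairing p q) = pairing q p := by
  simp [pairing, mul_comm]

theorem pairing_self {p : ℂ × ℂ} {v : Space3} (h : IsSpinor p v) :
    pairing p p = ((2 * ‖v‖ : ℝ) : ℂ) := by
  rw [pairing, mul_comm, h.fst, mul_comm, h.snd]
  push_cast
  ring

theorem spinMatrix_eq {p : ℂ × ℂ} {v : Space3} (h : IsSpinor p v) :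
    spinMatrix v = !![p.1 * conj p.1, p.1 * conj p.2; p.2 * conj p.1, p.2 * conj p.2] := by
  rw [spinMatrix, h.fst, h.snd, ← h.mixed]
  simp [mul_comm]

/-- Each spin matrix has rank one, so the trace of the product is a cyclic product of pairings. The
phases of the spinors cancel; the definition by matrices makes continuity visible, this form makes
computation possible. -/
theorem holonomy_eq {p₁ p₂ p₃ p₄ : ℂ × ℂ} {v₁ v₂ v₃ v₄ : Space3} (h₁ : IsSpinor p₁ v₁)
    (h₂ : IsSpinor p₂ v₂) (h₃ : IsSpinor p₃ v₃) (h₄ : IsSpinor p₄ v₄) :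
    holonomy v₁ v₂ v₃ v₄ =
      pairing p₁ p₂ * pairing p₂ p₃ * pairing p₃ p₄ * pairing p₄ p₁ := by
  rw [holonomy, spinMatrix_eq h₁, spinMatrix_eq h₂, spinMatrix_eq h₃, spinMatrix_eq h₄]
  simp only [Matrix.mul_fin_two, Matrix.trace_fin_two_of, pairing]
  ring

theorem holonomy_self (v : Space3) : holonomy v v v v = (((2 * ‖v‖) ^ 4 : ℝ) : ℂ) := by
  obtain ⟨p, hp⟩ := exists_isSpinor v
  rw [holonomy_eq hp hp hp hp, pairing_self hp]
  push_cast
  ring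

theorem arg_holonomy_first (v w : Space3) : (holonomy v w w v).arg = 0 := by
  obtain ⟨p, hp⟩ := exists_isSpinor v
  obtain ⟨q, hq⟩ := exists_isSpinor w
  have : holonomy v w w v = ((normSq (pairing p q) * (2 * ‖w‖) * (2 * ‖v‖) : ℝ) : ℂ) := by
    rw [holonomy_eq hp hq hq hp, pairing_self hp, pairing_self hq, ← conj_pairing p q]
    push_cast
    rw [normSq_eq_conj_mul_self]
    ring
  rw [this]
  exact arg_ofReal_of_nonneg (by have := normSq_nonneg (pairing p q); positivity)

theorem arg_holonomy_second (v w : Space3) : (holonomy v v w w).arg = 0 := by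
  have : holonomy v v w w = holonomy v w w v := by
    obtain ⟨p, hp⟩ := exists_isSpinor v
    obtain ⟨q, hq⟩ := exists_isSpinor w
    rw [holonomy_eq hp hp hq hq, holonomy_eq hp hq hq hp]
    ring
  rw [this, arg_holonomy_first]

theorem continuous_spinMatrix : Continuous spinMatrix := by
  have hp : Continuous planar := by
    have : planar = fun v : Space3 => ((v 0 : ℝ) : ℂ) + ((v 2 : ℝ) : ℂ) * I := by
      funext v
      apply Complex.ext <;> simp [planar]
    rw [this]
    fun_prop
  refine continuous_matrix fun i j => ?_
  fin_cases i <;> fin_cases j <;> simp [spinMatrix] <;> fun_prop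

theorem continuous_holonomy {X : Type*} [TopologicalSpace X] {f₁ f₂ f₃ f₄ : X → Space3}
    (h₁ : Continuous f₁) (h₂ : Continuous f₂) (h₃ : Continuous f₃) (h₄ : Continuous f₄) :
    Continuous fun x => holonomy (f₁ x) (f₂ x) (f₃ x) (f₄ x) := by
  have h := continuous_spinMatrix
  unfold holonomy
  fun_prop

/-- The reflection in the plane `z = 0`. -/
noncomputable def mirror (v : Space3) : Space3 := !₂[v 0, v 1, -v 2]

theorem norm_mirror (v : Space3) : ‖mirror v‖ = ‖v‖ := by
  rw [← sq_eq_sq₀ (norm_nonneg _) (norm_nonneg _), norm_sq_coords, norm_sq_coords]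
  simp [mirror]

/-- The reflection conjugates `planar v` and fixes the norm and `v 1`, so it conjugates every spin
matrix. -/
theorem holonomy_mirror (v₁ v₂ v₃ v₄ : Space3) :
    holonomy (mirror v₁) (mirror v₂) (mirror v₃) (mirror v₄) = conj (holonomy v₁ v₂ v₃ v₄) := by
  have h (v : Space3) : spinMatrix (mirror v) = (spinMatrix v).map conj := by
    have hp : planar (mirror v) = conj (planar v) := by
      apply Complex.ext <;> simp [planar, mirror]
    have h1 : mirror v 1 = v 1 := by simp [mirror]
    ext i j
    fin_cases i <;> fin_cases j <;> simp [spinMatrix, norm_mirror, hp, h1]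
  rw [holonomy, h, h, h, h, ← Matrix.map_mul, ← Matrix.map_mul, ← Matrix.map_mul, holonomy,
    Matrix.trace_fin_two, Matrix.trace_fin_two]
  simp

/-- The holonomy around the elementary square of side `2π / N` at the grid point `(i, j)`. -/
noncomputable def cellHolonomy (N : ℕ) (Φ : ℝ → ℝ → Space3) (i j : ℕ) : ℂ :=
  holonomy (Φ (i * (2 * Real.pi / N)) (j * (2 * Real.pi / N)))
    (Φ ((i + 1 : ℕ) * (2 * Real.pi / N)) (j * (2 * Real.pi / N)))
    (Φ ((i + 1 : ℕ) * (2 * Real.pi / N)) ((j + 1 : ℕ) * (2 * Real.pi / N)))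
    (Φ (i * (2 * Real.pi / N)) ((j + 1 : ℕ) * (2 * Real.pi / N)))

/-- The total curvature of the spinor bundle, seen on a grid with `N ^ 2` squares: for large `N`,
this is `2π` times the degree of `Φ` up to sign. -/
noncomputable def curvature (N : ℕ) (Φ : ℝ → ℝ → Space3) : ℝ :=
  ∑ i ∈ Finset.range N, ∑ j ∈ Finset.range N, (cellHolonomy N Φ i j).arg

theorem prod_range_shift {N : ℕ} (g : ℕ → ℂ) (h : g N = g 0) :
    ∏ i ∈ Finset.range N, g (i + 1) = ∏ i ∈ Finset.range N, g i := by
  cases N with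
  | zero => simp
  | succ k => rw [Finset.prod_range_succ, Finset.prod_range_succ', h]

/-- Every link of the closed grid borders two cells and enters their holonomies once as it is and
once conjugated. Hence the product of all holonomies is a nonnegative real, and the arguments add up
to a multiple of `2π`. -/
theorem exp_sum_arg_eq_one {N : ℕ} (g : ℕ → ℕ → Space3) (h₁ : ∀ j, g N j = g 0 j)
    (h₂ : ∀ i, g i N = g i 0)
    (h0 : ∀ i < N, ∀ j < N,
      holonomy (g i j) (g (i + 1) j) (g (i + 1) (j + 1)) (g i (j + 1)) ≠ 0) :
    exp ((∑ i ∈ Finset.range N, ∑ j ∈ Finset.range N,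
      (holonomy (g i j) (g (i + 1) j) (g (i + 1) (j + 1)) (g i (j + 1))).arg : ℝ) * I) = 1 := by
  choose ψ hψ using exists_isSpinor
  set T : ℕ → ℕ → ℂ := fun i j =>
    holonomy (g i j) (g (i + 1) j) (g (i + 1) (j + 1)) (g i (j + 1)) with hT
  set S : ℝ := ∑ i ∈ Finset.range N, ∑ j ∈ Finset.range N, (T i j).arg with hS
  set R : ℝ := ∏ i ∈ Finset.range N, ∏ j ∈ Finset.range N, ‖T i j‖ with hR
  have hRpos : 0 < R := Finset.prod_pos fun i hi => Finset.prod_pos fun j hj =>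
    norm_pos_iff.2 (h0 i (Finset.mem_range.1 hi) j (Finset.mem_range.1 hj))
  have hprod : (R : ℂ) * exp (S * I) = ∏ i ∈ Finset.range N, ∏ j ∈ Finset.range N, T i j := by
    rw [hR, hS]
    push_cast
    rw [Finset.sum_mul, exp_sum, ← Finset.prod_mul_distrib]
    refine Finset.prod_congr rfl fun i _ => ?_
    rw [Finset.sum_mul, exp_sum, ← Finset.prod_mul_distrib]
    exact Finset.prod_congr rfl fun j _ => norm_mul_exp_arg_mul_I _
  let L : ℕ → ℕ → ℂ := fun i j => pairing (ψ (g i j)) (ψ (g (i + 1) j))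
  let V : ℕ → ℕ → ℂ := fun i j => pairing (ψ (g i j)) (ψ (g i (j + 1)))
  have hTLV (i j : ℕ) : T i j = L i j * V (i + 1) j * conj (L i (j + 1)) * conj (V i j) := by
    simp only [hT, L, V]
    rw [holonomy_eq (hψ _) (hψ _) (hψ _) (hψ _), conj_pairing, conj_pairing]
  have hL : ∏ i ∈ Finset.range N, ∏ j ∈ Finset.range N, L i (j + 1) =
      ∏ i ∈ Finset.range N, ∏ j ∈ Finset.range N, L i j :=
    Finset.prod_congr rfl fun i _ => prod_range_shift (L i) (by simp only [L, h₂])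
  have hV : ∏ i ∈ Finset.range N, ∏ j ∈ Finset.range N, V (i + 1) j =
      ∏ i ∈ Finset.range N, ∏ j ∈ Finset.range N, V i j :=
    prod_range_shift (fun i => ∏ j ∈ Finset.range N, V i j) (by simp only [V, h₁])
  have hreal : ∏ i ∈ Finset.range N, ∏ j ∈ Finset.range N, T i j =
      ((normSq (∏ i ∈ Finset.range N, ∏ j ∈ Finset.range N, L i j) *
        normSq (∏ i ∈ Finset.range N, ∏ j ∈ Finset.range N, V i j) : ℝ) : ℂ) := by
    simp only [hTLV, Finset.prod_mul_distrib, ← map_prod]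
    rw [hL, hV]
    push_cast
    rw [← mul_conj, ← mul_conj]
    ring
  rw [hreal] at hprod
  set K : ℝ := normSq (∏ i ∈ Finset.range N, ∏ j ∈ Finset.range N, L i j) *
        normSq (∏ i ∈ Finset.range N, ∏ j ∈ Finset.range N, V i j) with hK
  have hK0 : 0 ≤ K := mul_nonneg (normSq_nonneg _) (normSq_nonneg _)
  have hKR : R = K := by
    have := congrArg norm hprod
    rwa [norm_mul, norm_exp_ofReal_mul_I, mul_one, norm_real, norm_real,
      Real.norm_of_nonneg hRpos.le, Real.norm_of_nonneg hK0] at this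
  rw [← hKR] at hprod
  exact mul_left_cancel₀ (by exact_mod_cast hRpos.ne') (hprod.trans (mul_one _).symm)

/-- Doubly `2π`-periodic continuous maps of the plane to punctured space. -/
structure IsTorusMap (Φ : ℝ → ℝ → Space3) : Prop where
  continuous : Continuous fun p : ℝ × ℝ => Φ p.1 p.2
  ne_zero : ∀ s u, Φ s u ≠ 0
  periodic_fst : ∀ s u, Φ (s + 2 * Real.pi) u = Φ s u
  periodic_snd : ∀ s u, Φ s (u + 2 * Real.pi) = Φ s u

/-- Two maps of the torus to punctured space are homotopic. -/
def TorusHomotopic (Φ Ψ : ℝ → ℝ → Space3) : Prop :=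
  ∃ H : ℝ → ℝ → ℝ → Space3,
    Continuous (fun p : ℝ × ℝ × ℝ => H p.1 p.2.1 p.2.2) ∧
    (∀ t ∈ Set.Icc (0 : ℝ) 1, ∀ s u, H t s u ≠ 0) ∧
    (∀ t s u, H t (s + 2 * Real.pi) u = H t s u) ∧
    (∀ t s u, H t s (u + 2 * Real.pi) = H t s u) ∧
    H 0 = Φ ∧ H 1 = Ψ

/-- At mesh zero the holonomy is `(2 * ‖v‖) ^ 4 > 0`; compactness of the parameter domain gives one
mesh that works everywhere. Positive real part keeps the holonomies off the cut of `arg`. -/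
theorem eventually_cellHolonomy_pos (H : ℝ → ℝ → ℝ → Space3)
    (hc : Continuous fun p : ℝ × ℝ × ℝ => H p.1 p.2.1 p.2.2)
    (h0 : ∀ t ∈ Set.Icc (0 : ℝ) 1, ∀ s u, H t s u ≠ 0) :
    ∀ᶠ N : ℕ in atTop, ∀ t ∈ Set.Icc (0 : ℝ) 1, ∀ i < N, ∀ j < N,
      0 < (cellHolonomy N (H t) i j).re := by
  let K : Set (ℝ × ℝ × ℝ) := Set.Icc 0 1 ×ˢ Set.Icc 0 (2 * Real.pi) ×ˢ Set.Icc 0 (2 * Real.pi)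
  have hK : IsCompact K := isCompact_Icc.prod (isCompact_Icc.prod isCompact_Icc)
  let f : ℝ × ℝ × ℝ × ℝ → ℝ := fun q =>
    (holonomy (H q.2.1 q.2.2.1 q.2.2.2) (H q.2.1 (q.2.2.1 + q.1) q.2.2.2)
      (H q.2.1 (q.2.2.1 + q.1) (q.2.2.2 + q.1)) (H q.2.1 q.2.2.1 (q.2.2.2 + q.1))).re
  have hf : Continuous f := by
    have e (a b c : ℝ × ℝ × ℝ × ℝ → ℝ) (ha : Continuous a) (hb : Continuous b)
        (hc' : Continuous c) : Continuous fun q => H (a q) (b q) (c q) :=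
      hc.comp (ha.prodMk (hb.prodMk hc'))
    refine continuous_re.comp (continuous_holonomy (e _ _ _ ?_ ?_ ?_) (e _ _ _ ?_ ?_ ?_)
      (e _ _ _ ?_ ?_ ?_) (e _ _ _ ?_ ?_ ?_)) <;> fun_prop
  have hev : ∀ᶠ d : ℝ in 𝓝 0, ∀ p ∈ K, 0 < f (d, p) := by
    refine hK.eventually_forall_of_forall_eventually fun p hp => ?_
    refine (hf.tendsto (0, p)).eventually (lt_mem_nhds ?_)
    have hne : H p.1 p.2.1 p.2.2 ≠ 0 := h0 _ hp.1 _ _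
    simp only [f, add_zero, holonomy_self, ofReal_re]
    have := norm_pos_iff.2 hne
    positivity
  have hlim : Tendsto (fun N : ℕ => 2 * Real.pi / (N : ℝ)) atTop (𝓝 0) :=
    tendsto_const_nhds.div_atTop tendsto_natCast_atTop_atTop
  filter_upwards [hlim.eventually hev, eventually_gt_atTop 0] with N hN hpos t ht i hi j hj
  have hNr : (0 : ℝ) < N := by exact_mod_cast hpos
  have hmem (k : ℕ) (hk : k < N) :
      (k : ℝ) * (2 * Real.pi / N) ∈ Set.Icc 0 (2 * Real.pi) := by
    constructor
    · positivity
    · have hk' : (k : ℝ) ≤ N := by exact_mod_cast hk.le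
      calc (k : ℝ) * (2 * Real.pi / N) ≤ N * (2 * Real.pi / N) := by gcongr
        _ = 2 * Real.pi := by field_simp
  have key := hN (t, i * (2 * Real.pi / N), j * (2 * Real.pi / N)) ⟨ht, hmem i hi, hmem j hj⟩
  have e (k : ℕ) : ((k + 1 : ℕ) : ℝ) * (2 * Real.pi / N) =
      k * (2 * Real.pi / N) + 2 * Real.pi / N := by
    push_cast
    ring
  simpa only [cellHolonomy, e] using key

/-- Along the homotopy the curvature is continuous with values in the discrete set `2πℤ`. -/
theorem TorusHomotopic.eventually_curvature_eq {Φ Ψ : ℝ → ℝ → Space3} (h : TorusHomotopic Φ Ψ) :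
    ∀ᶠ N : ℕ in atTop, curvature N Φ = curvature N Ψ := by
  obtain ⟨H, hc, h0, hp₁, hp₂, rfl, rfl⟩ := h
  filter_upwards [eventually_cellHolonomy_pos H hc h0, eventually_gt_atTop 0] with N hN hpos
  have hcell (i j : ℕ) : Continuous fun t => cellHolonomy N (H t) i j := by
    have e (b c : ℝ) : Continuous fun t => H t b c :=
      hc.comp (continuous_id.prodMk (continuous_const.prodMk continuous_const))
    exact continuous_holonomy (e _ _) (e _ _) (e _ _) (e _ _)
  have hcont : ContinuousOn (fun t => curvature N (H t)) (Set.Icc 0 1) := by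
    refine continuousOn_finsetSum _ fun i hi => continuousOn_finsetSum _ fun j hj => ?_
    intro t ht
    refine ContinuousAt.continuousWithinAt ?_
    exact ContinuousAt.comp (f := fun t => cellHolonomy N (H t) i j)
      (continuousAt_arg (Or.inl (hN t ht i (Finset.mem_range.1 hi) j (Finset.mem_range.1 hj))))
      (hcell i j).continuousAt
  have hint : ∀ t ∈ Set.Icc (0 : ℝ) 1, ∃ m : ℤ, curvature N (H t) = m * (2 * Real.pi) := by
    intro t ht
    have hN0 : (N : ℝ) ≠ 0 := by exact_mod_cast hpos.ne'
    have hwrap : (N : ℝ) * (2 * Real.pi / N) = (0 : ℕ) * (2 * Real.pi / N) + 2 * Real.pi := by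
      push_cast
      field_simp
      ring
    have := exp_sum_arg_eq_one (N := N)
      (fun i j => H t (i * (2 * Real.pi / N)) (j * (2 * Real.pi / N)))
      (fun j => by rw [hwrap, hp₁]) (fun i => by rw [hwrap, hp₂])
      (fun i hi j hj hz => by
        have h1 := hN t ht i hi j hj
        rw [cellHolonomy, hz] at h1
        simp at h1)
    obtain ⟨m, hm⟩ := exp_eq_one_iff.1 this
    refine ⟨m, ?_⟩
    have hm' : ((curvature N (H t) : ℝ) : ℂ) * I = ((m * (2 * Real.pi) : ℝ) : ℂ) * I := by
      rw [curvature]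
      refine Eq.trans hm ?_
      push_cast
      ring
    exact_mod_cast mul_right_cancel₀ I_ne_zero hm'
  have hmaps : ContinuousOn (fun t => curvature N (H t) / (2 * Real.pi)) (Set.Icc 0 1) :=
    hcont.div_const _
  have hdisc : IsDiscrete (Set.range ((↑) : ℤ → ℝ)) :=
    (Int.isClosedEmbedding_coe_real.isEmbedding).isDiscrete_range
  obtain ⟨y, -, hy⟩ := isPreconnected_Icc.eqOn_const_of_mapsTo hdisc hmaps
    (fun t ht => by
      obtain ⟨m, hm⟩ := hint t ht
      refine ⟨m, ?_⟩
      simp only [hm]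
      field_simp) ⟨_, ⟨0, rfl⟩⟩
  have e0 := hy (Set.left_mem_Icc.2 zero_le_one)
  have e1 := hy (Set.right_mem_Icc.2 zero_le_one)
  simp only [Function.const] at e0 e1
  have := e0.trans e1.symm
  field_simp at this
  exact this

theorem IsTorusMap.eventually_curvature_mirror {Φ : ℝ → ℝ → Space3} (h : IsTorusMap Φ) :
    ∀ᶠ N : ℕ in atTop, curvature N (fun s u => mirror (Φ s u)) = -curvature N Φ := by
  have := eventually_cellHolonomy_pos (fun _ => Φ) (h.continuous.comp continuous_snd)
    (fun _ _ => h.ne_zero)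
  filter_upwards [this] with N hN
  simp only [curvature, ← Finset.sum_neg_distrib]
  refine Finset.sum_congr rfl fun i hi => Finset.sum_congr rfl fun j hj => ?_
  have hpos := hN 0 (by simp) i (Finset.mem_range.1 hi) j (Finset.mem_range.1 hj)
  have hconj : cellHolonomy N (fun s u => mirror (Φ s u)) i j = conj (cellHolonomy N Φ i j) := by
    simp only [cellHolonomy, holonomy_mirror]
  rw [hconj, arg_conj, if_neg]
  -- Conjugation negates the argument except at `π`, which the positive real part excludes.
  rw [arg_eq_pi_iff]
  intro hlt
  linarith [hlt.1]

theorem curvature_eq_zero_of_const_fst {Φ : ℝ → ℝ → Space3} (h : ∀ s s' u, Φ s u = Φ s' u) (N : ℕ) :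
    curvature N Φ = 0 := by
  refine Finset.sum_eq_zero fun i _ => Finset.sum_eq_zero fun j _ => ?_
  rw [cellHolonomy, h ((i + 1 : ℕ) * _) (i * (2 * Real.pi / N)),
    h ((i + 1 : ℕ) * _) (i * (2 * Real.pi / N)), arg_holonomy_second]

theorem curvature_eq_zero_of_const_snd {Φ : ℝ → ℝ → Space3} (h : ∀ s u u', Φ s u = Φ s u') (N : ℕ) :
    curvature N Φ = 0 := by
  refine Finset.sum_eq_zero fun i _ => Finset.sum_eq_zero fun j _ => ?_
  rw [cellHolonomy, h _ ((j + 1 : ℕ) * _) (j * (2 * Real.pi / N)),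
    h _ ((j + 1 : ℕ) * _) (j * (2 * Real.pi / N)), arg_holonomy_first]

end TorusDegree

/-! ### The Hopf link has nonzero degree -/

namespace TorusDegree

/-! ### A map of the torus with explicitly computable cells. -/

open Complex Filter Topology ComplexConjugate

theorem isSpinor_polar {v : Space3} {y u : ℝ} (hy : |y| ≤ 1)
    (h0 : v 0 = Real.sqrt (1 + y) * Real.sqrt (1 - y) * Real.cos u) (h1 : v 1 = y)
    (h2 : v 2 = -(Real.sqrt (1 + y) * Real.sqrt (1 - y) * Real.sin u)) :
    IsSpinor ((Real.sqrt (1 + y) : ℂ), (Real.sqrt (1 - y) : ℂ) * exp (-(u * I))) v := by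
  have hy' := abs_le.1 hy
  have ha : Real.sqrt (1 + y) ^ 2 = 1 + y := Real.sq_sqrt (by linarith)
  have hb : Real.sqrt (1 - y) ^ 2 = 1 - y := Real.sq_sqrt (by linarith)
  have hn : ‖v‖ = 1 := by
    rw [← sq_eq_sq₀ (norm_nonneg _) zero_le_one, norm_sq_coords, h0, h1, h2]
    calc _ = Real.sqrt (1 + y) ^ 2 * Real.sqrt (1 - y) ^ 2 *
          (Real.sin u ^ 2 + Real.cos u ^ 2) + y ^ 2 := by ring
      _ = 1 ^ 2 := by rw [ha, hb, Real.sin_sq_add_cos_sq]; ring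
  have hexp : exp (-(u * I)) * conj (exp (-(u * I))) = 1 := by
    rw [← exp_conj, ← exp_add]
    simp
  refine ⟨?_, ?_, ?_⟩
  · simp only [conj_ofReal]
    rw [hn, h1, ← ofReal_mul, ← sq, ha]
  · simp only [map_mul, conj_ofReal]
    rw [hn, h1, mul_mul_mul_comm, hexp, mul_one, ← ofReal_mul, ← sq, hb]
  · have : exp (-(u * I)) = (Real.cos u : ℂ) - (Real.sin u : ℂ) * I := by
      rw [← neg_mul, exp_mul_I]
      simp [sub_eq_add_neg]
    simp only [conj_ofReal, this]
    generalize Real.cos u = c at *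
    generalize Real.sin u = z at *
    apply Complex.ext
    · simp [planar, h0]
      ring
    · simp [planar, h2]
      ring

/-- A map from the torus to the sphere that covers each parallel by the circles `s = const` while
`cos s ≤ 0`, and that retraces a meridian while `0 ≤ cos s`. -/
noncomputable def sweep (s u : ℝ) : Space3 :=
  !₂[max (-Real.cos s) 0 * Real.cos u - max (Real.cos s) 0, Real.sin s,
    -(max (-Real.cos s) 0 * Real.sin u)]

theorem isSpinor_sweep {s : ℝ} (hs : Real.cos s ≤ 0) (u : ℝ) :
    IsSpinor ((Real.sqrt (1 + Real.sin s) : ℂ),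
      (Real.sqrt (1 - Real.sin s) : ℂ) * exp (-(u * I))) (sweep s u) := by
  have hcos : Real.sqrt (1 + Real.sin s) * Real.sqrt (1 - Real.sin s) = -Real.cos s := by
    rw [← Real.sqrt_mul (by linarith [Real.neg_one_le_sin s])]
    rw [show (1 + Real.sin s) * (1 - Real.sin s) = (-Real.cos s) ^ 2 by
      linear_combination -Real.sin_sq_add_cos_sq s]
    exact Real.sqrt_sq (by linarith)
  have hmax : max (-Real.cos s) 0 = -Real.cos s := max_eq_left (by linarith)
  have hmax' : max (Real.cos s) 0 = 0 := max_eq_right hs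
  apply isSpinor_polar (Real.abs_sin_le_one s) <;> simp [sweep, hcos, hmax, hmax']

/-- With heights `y = sin s` and `y' = sin s'`, the two meridian links are the same real number `ρ`,
and the two parallel links give the holonomy the imaginary part `ρ ^ 2 * (2 * sin d * (y' - y))`. -/
theorem arg_holonomy_sweep_neg {s s' u d : ℝ} (hs : Real.cos s ≤ 0) (hs' : Real.cos s' ≤ 0)
    (hlt : Real.sin s' < Real.sin s)
    (hlt₂ : Real.sin s - Real.sin s' < 2) (hd : 0 < Real.sin d) :
    (holonomy (sweep s u) (sweep s' u) (sweep s' (u + d)) (sweep s (u + d))).arg < 0 := by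
  rw [arg_neg_iff, holonomy_eq (isSpinor_sweep hs _) (isSpinor_sweep hs' _) (isSpinor_sweep hs' _)
    (isSpinor_sweep hs _)]
  have hb1 := Real.neg_one_le_sin s
  have hb2 := Real.sin_le_one s
  have hb1' := Real.neg_one_le_sin s'
  have hb2' := Real.sin_le_one s'
  generalize hy : Real.sin s = y at *
  generalize hy' : Real.sin s' = y' at *
  have hA : (Real.sqrt (1 + y) : ℂ) ^ 2 = 1 + y := by
    rw [← ofReal_pow, Real.sq_sqrt (by linarith)]; push_cast; ring
  have hB : (Real.sqrt (1 - y) : ℂ) ^ 2 = 1 - y := by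
    rw [← ofReal_pow, Real.sq_sqrt (by linarith)]; push_cast; ring
  have hA' : (Real.sqrt (1 + y') : ℂ) ^ 2 = 1 + y' := by
    rw [← ofReal_pow, Real.sq_sqrt (by linarith)]; push_cast; ring
  have hB' : (Real.sqrt (1 - y') : ℂ) ^ 2 = 1 - y' := by
    rw [← ofReal_pow, Real.sq_sqrt (by linarith)]; push_cast; ring
  set ρ : ℝ := Real.sqrt (1 + y) * Real.sqrt (1 + y') + Real.sqrt (1 - y) * Real.sqrt (1 - y')
    with hρ
  -- Given `y' < y`, `ρ` could vanish only for opposite poles, `y = 1` and `y' = -1`; `hlt₂` rules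
  -- this out.
  have hρpos : 0 < ρ := by
    have h1 : 0 < Real.sqrt (1 + y) := Real.sqrt_pos.2 (by linarith)
    have h2 : 0 < Real.sqrt (1 - y') := Real.sqrt_pos.2 (by linarith)
    have h3 := Real.sqrt_nonneg (1 + y')
    have h4 := Real.sqrt_nonneg (1 - y)
    rcases lt_or_ge (-1) y' with h | h
    · have : 0 < Real.sqrt (1 + y') := Real.sqrt_pos.2 (by linarith)
      positivity
    · rcases lt_or_ge y 1 with h' | h'
      · have : 0 < Real.sqrt (1 - y) := Real.sqrt_pos.2 (by linarith)
        positivity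
      · linarith
  have hunit (x : ℝ) : conj (exp (-(x * I))) * exp (-(x * I)) = 1 := by
    rw [← exp_conj, ← exp_add]
    simp
  have hshift : exp (-((u + d : ℝ) * I)) = exp (-(u * I)) * exp (-(d * I)) := by
    rw [← exp_add]
    push_cast
    ring_nf
  have e1 : pairing ((Real.sqrt (1 + y) : ℂ), (Real.sqrt (1 - y) : ℂ) * exp (-(u * I)))
      ((Real.sqrt (1 + y') : ℂ), (Real.sqrt (1 - y') : ℂ) * exp (-(u * I))) = ρ := by
    simp only [pairing, map_mul, conj_ofReal, hρ]
    push_cast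
    linear_combination (Real.sqrt (1 - y) : ℂ) * (Real.sqrt (1 - y') : ℂ) * hunit u
  have e3 : pairing ((Real.sqrt (1 + y') : ℂ), (Real.sqrt (1 - y') : ℂ) * exp (-((u + d : ℝ) * I)))
      ((Real.sqrt (1 + y) : ℂ), (Real.sqrt (1 - y) : ℂ) * exp (-((u + d : ℝ) * I))) = ρ := by
    simp only [pairing, map_mul, conj_ofReal, hρ]
    have := hunit (u + d)
    push_cast at this ⊢
    linear_combination (Real.sqrt (1 - y) : ℂ) * (Real.sqrt (1 - y') : ℂ) * this
  have e2 : pairing ((Real.sqrt (1 + y') : ℂ), (Real.sqrt (1 - y') : ℂ) * exp (-(u * I)))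
      ((Real.sqrt (1 + y') : ℂ), (Real.sqrt (1 - y') : ℂ) * exp (-((u + d : ℝ) * I))) =
      (1 + y') + (1 - y') * exp (-(d * I)) := by
    simp only [pairing, map_mul, conj_ofReal, hshift]
    linear_combination hA' + exp (-(d * I)) * hB' +
      (Real.sqrt (1 - y') : ℂ) ^ 2 * exp (-(d * I)) * hunit u
  have e4 : pairing ((Real.sqrt (1 + y) : ℂ), (Real.sqrt (1 - y) : ℂ) * exp (-((u + d : ℝ) * I)))
      ((Real.sqrt (1 + y) : ℂ), (Real.sqrt (1 - y) : ℂ) * exp (-(u * I))) =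
      (1 + y) + (1 - y) * conj (exp (-(d * I))) := by
    simp only [pairing, map_mul, conj_ofReal, hshift]
    linear_combination hA + conj (exp (-(d * I))) * hB +
      (Real.sqrt (1 - y) : ℂ) ^ 2 * conj (exp (-(d * I))) * hunit u
  rw [e1, e2, e3, e4]
  have hexp : exp (-(d * I)) = (Real.cos d : ℂ) - (Real.sin d : ℂ) * I := by
    rw [← neg_mul, exp_mul_I]
    simp [sub_eq_add_neg]
  have him : ((ρ : ℂ) * ((1 + y') + (1 - y') * exp (-(d * I))) * ρ *
      ((1 + y) + (1 - y) * conj (exp (-(d * I))))).im =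
      ρ ^ 2 * (2 * Real.sin d * (y' - y)) := by
    rw [hexp]
    generalize Real.cos d = c
    generalize Real.sin d = z
    simp
    ring
  rw [him]
  exact mul_neg_of_pos_of_neg (by positivity) (mul_neg_of_pos_of_neg (by positivity) (by linarith))

theorem sweep_eq_of_cos_nonneg {s : ℝ} (hs : 0 ≤ Real.cos s) (u u' : ℝ) :
    sweep s u = sweep s u' := by
  have : max (-Real.cos s) 0 = 0 := max_eq_right (by linarith)
  simp [sweep, this]

/-- With `4 * M` steps, `π / 2` and `3π / 2` are grid values, so no cell straddles a sign change of
`cos s`. Cells with `cos s ≤ 0` contribute negatively, the others nothing, so no limit has to be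
computed. -/
theorem curvature_sweep_neg {M : ℕ} (hM : 0 < M) : curvature (4 * M) sweep < 0 := by
  have hMr : (0 : ℝ) < M := by exact_mod_cast hM
  have hM1 : (1 : ℝ) ≤ M := by exact_mod_cast hM
  set d : ℝ := 2 * Real.pi / ((4 * M : ℕ) : ℝ) with hd
  have hdM : M * d = Real.pi / 2 := by
    rw [hd]
    push_cast
    field_simp
    ring
  have hd0 : 0 < d := by rw [hd]; positivity
  have hdle : d ≤ Real.pi / 2 := by nlinarith
  have hstep (k : ℕ) : ((k + 1 : ℕ) : ℝ) * d = k * d + d := by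
    push_cast
    ring
  have hfront (i j : ℕ) (h₁ : M ≤ i) (h₂ : i + 1 ≤ 3 * M) :
      (cellHolonomy (4 * M) sweep i j).arg < 0 := by
    have h₁' : (M : ℝ) ≤ i := by exact_mod_cast h₁
    have h₂' : ((i + 1 : ℕ) : ℝ) ≤ 3 * M := by exact_mod_cast h₂
    have hlow : Real.pi / 2 ≤ i * d := by nlinarith
    have hupp : ((i + 1 : ℕ) : ℝ) * d ≤ Real.pi + Real.pi / 2 := by nlinarith
    have hs : Real.cos (i * d) ≤ 0 :=
      Real.cos_nonpos_of_pi_div_two_le_of_le hlow (by linarith [hstep i])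
    have hs' : Real.cos (((i + 1 : ℕ) : ℝ) * d) ≤ 0 :=
      Real.cos_nonpos_of_pi_div_two_le_of_le (by linarith [hstep i]) (by linarith)
    have hlt : Real.sin (((i + 1 : ℕ) : ℝ) * d) < Real.sin (i * d) := by
      have := Real.sin_lt_sin_of_lt_of_le_pi_div_two (x := Real.pi - ((i + 1 : ℕ) : ℝ) * d)
        (y := Real.pi - i * d) (by linarith) (by linarith) (by linarith [hstep i])
      rwa [Real.sin_pi_sub, Real.sin_pi_sub] at this
    have hlt₂ : Real.sin (i * d) - Real.sin (((i + 1 : ℕ) : ℝ) * d) < 2 := by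
      have h := Real.abs_sin_sub_sin_le (i * d) (((i + 1 : ℕ) : ℝ) * d)
      rw [hstep, show i * d - (i * d + d) = -d by ring, abs_neg, abs_of_pos hd0] at h
      rw [hstep]
      linarith [le_abs_self (Real.sin (i * d) - Real.sin (i * d + d)), Real.pi_lt_four]
    rw [cellHolonomy, ← hd, hstep j]
    exact arg_holonomy_sweep_neg hs hs' hlt hlt₂
      (Real.sin_pos_of_pos_of_lt_pi hd0 (by linarith [Real.pi_pos]))
  have hback (i j : ℕ) (h : i + 1 ≤ M ∨ 3 * M ≤ i ∧ i + 1 ≤ 4 * M) :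
      (cellHolonomy (4 * M) sweep i j).arg = 0 := by
    have hcos : 0 ≤ Real.cos (i * d) ∧ 0 ≤ Real.cos (((i + 1 : ℕ) : ℝ) * d) := by
      rcases h with h | ⟨h₁, h₂⟩
      · have h' : ((i + 1 : ℕ) : ℝ) ≤ M := by exact_mod_cast h
        have hupp : ((i + 1 : ℕ) : ℝ) * d ≤ Real.pi / 2 := by nlinarith
        have h0 : 0 ≤ i * d := by positivity
        exact ⟨Real.cos_nonneg_of_neg_pi_div_two_le_of_le (by linarith [Real.pi_pos])
            (by linarith [hstep i]),
          Real.cos_nonneg_of_neg_pi_div_two_le_of_le (by linarith [Real.pi_pos, hstep i]) hupp⟩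
      · have h₁' : 3 * (M : ℝ) ≤ i := by exact_mod_cast h₁
        have h₂' : ((i + 1 : ℕ) : ℝ) ≤ 4 * M := by exact_mod_cast h₂
        have hlow : 3 * (Real.pi / 2) ≤ i * d := by nlinarith
        have hupp : ((i + 1 : ℕ) : ℝ) * d ≤ 2 * Real.pi := by nlinarith
        rw [← Real.cos_sub_two_pi (i * d), ← Real.cos_sub_two_pi (((i + 1 : ℕ) : ℝ) * d)]
        exact ⟨Real.cos_nonneg_of_neg_pi_div_two_le_of_le (by linarith)
            (by linarith [Real.pi_pos, hstep i]),
          Real.cos_nonneg_of_neg_pi_div_two_le_of_le (by linarith [hstep i])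
            (by linarith [Real.pi_pos])⟩
    rw [cellHolonomy, ← hd, sweep_eq_of_cos_nonneg hcos.1 (((j + 1 : ℕ) : ℝ) * d) (j * d),
      sweep_eq_of_cos_nonneg hcos.2 (((j + 1 : ℕ) : ℝ) * d) (j * d), arg_holonomy_first]
  have hle (i j : ℕ) (hi : i < 4 * M) : (cellHolonomy (4 * M) sweep i j).arg ≤ 0 := by
    by_cases h : M ≤ i ∧ i + 1 ≤ 3 * M
    · exact (hfront i j h.1 h.2).le
    · exact (hback i j (by omega)).le
  have hMmem : M ∈ Finset.range (4 * M) := Finset.mem_range.2 (by omega)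
  refine Finset.sum_neg' (fun i hi => Finset.sum_nonpos fun j _ => hle i j (Finset.mem_range.1 hi))
    ⟨M, hMmem, ?_⟩
  exact Finset.sum_neg' (fun j _ => hle M j (Finset.mem_range.1 hMmem))
    ⟨M, hMmem, hfront M M le_rfl (by omega)⟩

end TorusDegree

/-! ### The standard Hopf link: its degree, and reversal of both components. -/

namespace HopfLadder

open Filter TorusDegree

theorem continuous_side₁ : Continuous side₁ := by
  refine (PiLp.continuous_toLp 2 _).comp (continuous_pi fun i => ?_)
  fin_cases i <;> simp <;> fun_prop

theorem continuous_side₂ : Continuous side₂ := by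
  refine (PiLp.continuous_toLp 2 _).comp (continuous_pi fun i => ?_)
  fin_cases i <;> simp <;> fun_prop

theorem side₁_ne_side₂ (s u : ℝ) : side₁ s ≠ side₂ u := by
  intro h
  have h0 := congrArg (fun v : Space3 => v 0) h
  have h1 := congrArg (fun v : Space3 => v 1) h
  have h2 := congrArg (fun v : Space3 => v 2) h
  simp [side₁, side₂] at h0 h1 h2
  have hs := Real.sin_sq_add_cos_sq s
  have hu := Real.sin_sq_add_cos_sq u
  rw [h1] at hs
  rw [← h2] at hu
  have hs' : (Real.cos s - 1) * (Real.cos s + 1) = 0 := by nlinarith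
  have hu' : (Real.cos u - 1) * (Real.cos u + 1) = 0 := by nlinarith
  rcases mul_eq_zero.1 hs' with h | h <;> rcases mul_eq_zero.1 hu' with h' | h' <;> linarith

theorem isTorusMap_sub {γ δ : ℝ → Space3} (hγ : Continuous γ) (hδ : Continuous δ)
    (hγp : ∀ s, γ (s + 2 * Real.pi) = γ s) (hδp : ∀ s, δ (s + 2 * Real.pi) = δ s)
    (hne : ∀ s u, γ s ≠ δ u) : IsTorusMap fun s u => γ s - δ u where
  continuous := (hγ.comp continuous_fst).sub (hδ.comp continuous_snd)
  ne_zero s u := sub_ne_zero.2 (hne s u)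
  periodic_fst s u := by rw [hγp]
  periodic_snd s u := by rw [hδp]

/-- The straight-line homotopy works: the `y`-coordinate stays `sin s`, so a zero needs `cos s =
±1`. There the `x`-coordinate is negative, or the `x`- and `z`-coordinates are `cos u` and `-sin u`.
-/
theorem torusHomotopic_sweep : TorusHomotopic (fun s u => side₁ s - side₂ u) sweep := by
  refine ⟨fun t s u => !₂[((1 - t) + t * max (-Real.cos s) 0) * Real.cos u -
      ((1 - t) * (1 + Real.cos s) + t * max (Real.cos s) 0), Real.sin s,
      -(((1 - t) + t * max (-Real.cos s) 0) * Real.sin u)], ?_, ?_, ?_, ?_, ?_, ?_⟩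
  · refine (PiLp.continuous_toLp 2 _).comp (continuous_pi fun i => ?_)
    fin_cases i <;> simp <;> fun_prop
  · intro t ht s u h
    have h0 := congrArg (fun v : Space3 => v 0) h
    have h1 := congrArg (fun v : Space3 => v 1) h
    have h2 := congrArg (fun v : Space3 => v 2) h
    simp only [Matrix.cons_val_zero, Matrix.cons_val_one, Matrix.cons_val, PiLp.zero_apply]
      at h0 h1 h2
    have hs := Real.sin_sq_add_cos_sq s
    have hu := Real.sin_sq_add_cos_sq u
    rw [h1] at hs
    have hs' : (Real.cos s - 1) * (Real.cos s + 1) = 0 := by nlinarith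
    rcases mul_eq_zero.1 hs' with h | h
    · have hc : Real.cos s = 1 := by linarith
      rw [hc] at h0 h2
      norm_num at h0 h2
      nlinarith [Real.cos_le_one u, ht.1, ht.2]
    · have hc : Real.cos s = -1 := by linarith
      rw [hc] at h0 h2
      norm_num at h0 h2
      rw [h0, h2] at hu
      norm_num at hu
  · intro t s u
    simp
  · intro t s u
    simp
  · funext s u
    ext i
    fin_cases i <;> simp [side₁, side₂]
    ring
  · funext s u
    simp [sweep]

theorem frequently_curvature_ne_zero :
    ∃ᶠ N : ℕ in atTop, curvature N (fun s u => side₁ s - side₂ u) ≠ 0 := by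
  have h := torusHomotopic_sweep.eventually_curvature_eq
  obtain ⟨N₀, hN₀⟩ := eventually_atTop.1 h
  -- A multiple of four that exceeds both `N` and the threshold `N₀` of the homotopy.
  refine frequently_atTop.2 fun N => ⟨4 * (N + N₀ + 1), by omega, ?_⟩
  rw [hN₀ _ (by omega)]
  exact (curvature_sweep_neg (by omega)).ne

/-- The half turn about the `x`-axis reverses both circles; the homotopy rotates the difference
vector by the angle `t * π`. -/
theorem torusHomotopic_neg_neg :
    TorusHomotopic (fun s u => side₁ (-s) - side₂ (-u)) (fun s u => side₁ s - side₂ u) := by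
  refine ⟨fun t s u => !₂[-Real.cos s - 1 + Real.cos u,
    -(Real.cos (t * Real.pi) * Real.sin s - Real.sin (t * Real.pi) * Real.sin u),
    Real.sin (t * Real.pi) * Real.sin s + Real.cos (t * Real.pi) * Real.sin u], ?_, ?_, ?_, ?_,
    ?_, ?_⟩
  · refine (PiLp.continuous_toLp 2 _).comp (continuous_pi fun i => ?_)
    fin_cases i <;> simp <;> fun_prop
  · intro t ht s u h
    have h0 := congrArg (fun v : Space3 => v 0) h
    have h1 := congrArg (fun v : Space3 => v 1) h
    have h2 := congrArg (fun v : Space3 => v 2) h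
    simp only [Matrix.cons_val_zero, Matrix.cons_val_one, Matrix.cons_val, PiLp.zero_apply]
      at h0 h1 h2
    have ht' := Real.sin_sq_add_cos_sq (t * Real.pi)
    have e1 : Real.sin s = 0 := by
      linear_combination (-Real.sin s) * ht' - Real.cos (t * Real.pi) * h1 +
        Real.sin (t * Real.pi) * h2
    have e2 : Real.sin u = 0 := by
      linear_combination (-Real.sin u) * ht' + Real.sin (t * Real.pi) * h1 +
        Real.cos (t * Real.pi) * h2
    refine side₁_ne_side₂ s u ?_
    ext i
    fin_cases i <;> simp [side₁, side₂, e1, e2]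
    linarith
  · intro t s u
    simp
  · intro t s u
    simp
  · funext s u
    ext i
    fin_cases i <;> simp [side₁, side₂]
    ring
  · funext s u
    ext i
    fin_cases i <;> simp [side₁, side₂]
    ring

end HopfLadder

/-! ### The Hopf band -/

namespace HopfLadder

open Filter TorusDegree

/-- The Hopf band: the union of the segments from `side₁ α` to `side₂ α`. -/
noncomputable def band (α τ : ℝ) : Space3 :=
  !₂[τ - Real.cos α, (1 - τ) * Real.sin α, τ * Real.sin α]

/-- The Hopf band, pushed off itself by an amount `η`. -/
noncomputable def pushedBand (η α τ : ℝ) : Space3 :=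
  !₂[τ - (1 - η * Real.sin α) * Real.cos α,
    (1 - τ) * ((1 - η * Real.sin α) * Real.sin α) + η * Real.cos α / 2,
    τ * ((1 - η * Real.sin α) * Real.sin α) - η * Real.cos α / 2]

theorem band_zero (α : ℝ) : band α 0 = side₁ α := by simp [band, side₁]

theorem band_one (α : ℝ) : band α 1 = side₂ α := by simp [band, side₂]

theorem pushedBand_zero (α τ : ℝ) : pushedBand 0 α τ = band α τ := by simp [band, pushedBand]

theorem band_add_int_mul_two_pi (α τ : ℝ) (w : ℤ) : band (α + w * (2 * Real.pi)) τ = band α τ := by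
  simp [band, Real.cos_add_int_mul_two_pi, Real.sin_add_int_mul_two_pi]

theorem pushedBand_add_int_mul_two_pi (η α τ : ℝ) (w : ℤ) :
    pushedBand η (α + w * (2 * Real.pi)) τ = pushedBand η α τ := by
  simp [pushedBand, Real.cos_add_int_mul_two_pi, Real.sin_add_int_mul_two_pi]

theorem continuous_band {X : Type*} [TopologicalSpace X] {α τ : X → ℝ} (hα : Continuous α)
    (hτ : Continuous τ) : Continuous fun x => band (α x) (τ x) := by
  refine (PiLp.continuous_toLp 2 _).comp (continuous_pi fun i => ?_)
  fin_cases i <;> simp <;> fun_prop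

theorem continuous_pushedBand {X : Type*} [TopologicalSpace X] {η α τ : X → ℝ} (hη : Continuous η)
    (hα : Continuous α) (hτ : Continuous τ) :
    Continuous fun x => pushedBand (η x) (α x) (τ x) := by
  refine (PiLp.continuous_toLp 2 _).comp (continuous_pi fun i => ?_)
  fin_cases i <;> simp <;> fun_prop

/-- The algebraic core of the injectivity of the parametrization of the band. -/
theorem band_coords_unique {C S C' S' τ τ' : ℝ} (h : S ^ 2 + C ^ 2 = 1) (h' : S' ^ 2 + C' ^ 2 = 1)
    (hτ : τ ∈ Set.Icc (0 : ℝ) 1) (hτ' : τ' ∈ Set.Icc (0 : ℝ) 1) (h0 : τ - C = τ' - C')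
    (h1 : (1 - τ) * S = (1 - τ') * S') (h2 : τ * S = τ' * S') : C = C' ∧ S = S' ∧ τ = τ' := by
  have hS : S = S' := by linarith
  subst hS
  have hD : (C - C') * S = 0 := by linear_combination h2 - S * h0
  rcases mul_eq_zero.1 hD with h3 | h3
  · exact ⟨by linarith, rfl, by linarith⟩
  -- Now both cosines are `±1`; if they differed, `τ` and `τ'` would be at distance two.
  · subst h3
    have hC : (C - 1) * (C + 1) = 0 := by linarith
    have hC' : (C' - 1) * (C' + 1) = 0 := by linarith
    have := hτ.1; have := hτ.2; have := hτ'.1; have := hτ'.2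
    rcases mul_eq_zero.1 hC with h3 | h3 <;> rcases mul_eq_zero.1 hC' with h4 | h4
    · exact ⟨by linarith, rfl, by linarith⟩
    · linarith
    · linarith
    · exact ⟨by linarith, rfl, by linarith⟩

theorem band_injective {α α' τ τ' : ℝ} (hτ : τ ∈ Set.Icc (0 : ℝ) 1) (hτ' : τ' ∈ Set.Icc (0 : ℝ) 1)
    (h : band α τ = band α' τ') : (∃ w : ℤ, α' = α + w * (2 * Real.pi)) ∧ τ = τ' := by
  have h0 := congrArg (fun v : Space3 => v 0) h
  have h1 := congrArg (fun v : Space3 => v 1) h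
  have h2 := congrArg (fun v : Space3 => v 2) h
  simp only [band, Matrix.cons_val_zero, Matrix.cons_val_one, Matrix.cons_val] at h0 h1 h2
  obtain ⟨hC, hS, ht⟩ := band_coords_unique (Real.sin_sq_add_cos_sq α) (Real.sin_sq_add_cos_sq α')
    hτ hτ' h0 h1 h2
  refine ⟨?_, ht⟩
  obtain ⟨w, hw⟩ := Real.Angle.angle_eq_iff_two_pi_dvd_sub.1
    (Real.Angle.cos_sin_inj hC.symm hS.symm)
  exact ⟨w, by linarith⟩

/-- To first order, the push-off is transverse to the band: its product with the normal `∂τ × ∂α` is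
`-(sin² α + cos² α / 2)`. For finite `η`, the sum of the last two coordinates gives `S' = r * S`
with `r = 1 - η * S`. Eliminating the rest yields `S ≥ η` and `r² * S * (1 + r * S²) = η * C² / 4`,
which is impossible for `r ≥ 1 / 2`. -/
theorem pushedBand_ne_band {η α α' τ τ' : ℝ} (hη : 0 < η) (hη' : η ≤ 1 / 2)
    (hτ : τ ∈ Set.Icc (0 : ℝ) 1) (hτ' : τ' ∈ Set.Icc (0 : ℝ) 1) :
    pushedBand η α τ ≠ band α' τ' := by
  intro h
  have h0 := congrArg (fun v : Space3 => v 0) h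
  have h1 := congrArg (fun v : Space3 => v 1) h
  have h2 := congrArg (fun v : Space3 => v 2) h
  simp only [band, pushedBand, Matrix.cons_val_zero, Matrix.cons_val_one, Matrix.cons_val]
    at h0 h1 h2
  have e := Real.sin_sq_add_cos_sq α
  have e' := Real.sin_sq_add_cos_sq α'
  have hS1 := Real.sin_le_one α
  have hS2 := Real.neg_one_le_sin α
  generalize Real.sin α = S at *
  generalize Real.cos α = C at *
  generalize Real.sin α' = S' at *
  generalize Real.cos α' = C' at *
  obtain ⟨r, hr⟩ : ∃ r, r = 1 - η * S := ⟨_, rfl⟩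
  rw [← hr] at h0 h1 h2
  have hr2 : 1 / 2 ≤ r := by nlinarith
  have hS' : S' = r * S := by linarith
  subst hS'
  obtain ⟨D, hD⟩ : ∃ D, D = τ - τ' := ⟨_, rfl⟩
  have hDle : D ^ 2 ≤ 1 := by
    rw [sq_le_one_iff_abs_le_one, abs_le]
    constructor <;> linarith [hτ.1, hτ.2, hτ'.1, hτ'.2]
  have hC' : C' = r * C - D := by linarith
  subst hC'
  have k1 : D * (r * S) = η * C / 2 := by rw [hD]; linarith
  have k2 : D ^ 2 * S = η * (1 + r * S ^ 2) := by
    have : 1 = r ^ 2 - 2 * r * C * D + D ^ 2 := by linear_combination -e' + r ^ 2 * e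
    have hrr : 1 - r ^ 2 = η * S * (1 + r) := by rw [hr]; ring
    linear_combination -S * this + S * hrr + 2 * C * k1 + η * e
  have hrhs : η ≤ η * (1 + r * S ^ 2) := by
    have : 0 ≤ η * (r * S ^ 2) := by positivity
    linarith
  have hSpos : 0 < S := by
    by_contra hneg
    nlinarith [sq_nonneg D]
  have hSη : η ≤ S := by nlinarith
  have k3 : r ^ 2 * S * (1 + r * S ^ 2) = η * C ^ 2 / 4 := by
    have : η * (r ^ 2 * S * (1 + r * S ^ 2)) = η * (η * C ^ 2 / 4) := by
      linear_combination (-r ^ 2 * S) * k2 + (D * (r * S) + η * C / 2) * k1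
    exact mul_left_cancel₀ hη.ne' this
  have hr4 : 1 / 4 ≤ r ^ 2 := by nlinarith
  have k4 : η / 4 ≤ r ^ 2 * S := by nlinarith
  have k5 : r ^ 2 * S < r ^ 2 * S * (1 + r * S ^ 2) := by
    have : 0 < r ^ 2 * S * (r * S ^ 2) := by positivity
    linarith
  have k6 : η * C ^ 2 / 4 ≤ η / 4 := by nlinarith [sq_nonneg S]
  linarith

/-- The linking of two disjoint loops in the Hopf band depends only on how often they wind around
the band. -/
theorem eventually_curvature_eq_of_band {α τ α' τ' : ℝ → ℝ} {w w' : ℤ} (hα : Continuous α)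
    (hτ : Continuous τ) (hα' : Continuous α') (hτ' : Continuous τ')
    (hτI : ∀ s, τ s ∈ Set.Icc (0 : ℝ) 1) (hτI' : ∀ s, τ' s ∈ Set.Icc (0 : ℝ) 1)
    (hαp : ∀ s, α (s + 2 * Real.pi) = α s + w * (2 * Real.pi))
    (hαp' : ∀ s, α' (s + 2 * Real.pi) = α' s + w' * (2 * Real.pi))
    (hτp : ∀ s, τ (s + 2 * Real.pi) = τ s) (hτp' : ∀ s, τ' (s + 2 * Real.pi) = τ' s)
    (hne : ∀ s u, band (α s) (τ s) ≠ band (α' u) (τ' u)) :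
    ∀ᶠ N : ℕ in atTop, curvature N (fun s u => band (α s) (τ s) - band (α' u) (τ' u)) =
      curvature N (fun s u => side₁ (w * s) - side₂ (w' * u)) := by
  -- Push the first loop off the band; the loops are disjoint at `t = 0` by assumption and for `t >
  -- 0` by transversality.
  have h₁ : TorusHomotopic (fun s u => band (α s) (τ s) - band (α' u) (τ' u))
      (fun s u => pushedBand (1 / 2) (α s) (τ s) - band (α' u) (τ' u)) := by
    refine ⟨fun t s u => pushedBand (t / 2) (α s) (τ s) - band (α' u) (τ' u), ?_, ?_, ?_, ?_, ?_,
      ?_⟩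
    · exact (continuous_pushedBand (by fun_prop) (by fun_prop) (by fun_prop)).sub
        (continuous_band (by fun_prop) (by fun_prop))
    · intro t ht s u
      rw [sub_ne_zero]
      rcases ht.1.eq_or_lt with h | h
      · rw [← h, zero_div, pushedBand_zero]
        exact hne s u
      · exact pushedBand_ne_band (by linarith) (by linarith [ht.2]) (hτI s) (hτI' u)
    · intro t s u
      beta_reduce
      rw [hαp, hτp, pushedBand_add_int_mul_two_pi]
    · intro t s u
      beta_reduce
      rw [hαp', hτp', band_add_int_mul_two_pi]
    · simp only [zero_div, pushedBand_zero]
    · rfl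
  -- The loops can no longer collide, so their lifts are straightened linearly and moved to opposite
  -- sides of the band.
  have h₂ : TorusHomotopic (fun s u => pushedBand (1 / 2) (α s) (τ s) - band (α' u) (τ' u))
      (fun s u => pushedBand (1 / 2) (w * s) 0 - band (w' * u) 1) := by
    refine ⟨fun t s u => pushedBand (1 / 2) ((1 - t) * α s + t * (w * s)) ((1 - t) * τ s) -
      band ((1 - t) * α' u + t * (w' * u)) ((1 - t) * τ' u + t), ?_, ?_, ?_, ?_, ?_, ?_⟩
    · exact (continuous_pushedBand (by fun_prop) (by fun_prop) (by fun_prop)).sub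
        (continuous_band (by fun_prop) (by fun_prop))
    · intro t ht s u
      rw [sub_ne_zero]
      have h1 := hτI s
      have h2 := hτI' u
      have h3 : 0 ≤ 1 - t := by linarith [ht.2]
      refine pushedBand_ne_band (by norm_num) le_rfl ⟨mul_nonneg h3 h1.1, ?_⟩ ⟨?_, ?_⟩
      · nlinarith [h1.2, ht.1]
      · have := mul_nonneg h3 h2.1
        linarith [ht.1]
      · nlinarith [h2.2]
    · intro t s u
      beta_reduce
      rw [hαp, hτp, ← pushedBand_add_int_mul_two_pi _ ((1 - t) * α s + t * (w * s)) _ w]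
      ring_nf
    · intro t s u
      beta_reduce
      rw [hαp', hτp', ← band_add_int_mul_two_pi ((1 - t) * α' u + t * (w' * u)) _ w']
      ring_nf
    · simp
    · simp
  -- Undo the push, which is allowed because the two sides are disjoint.
  have h₃ : TorusHomotopic (fun s u => pushedBand (0 / 2) (w * s) 0 - band (w' * u) 1)
      (fun s u => pushedBand (1 / 2) (w * s) 0 - band (w' * u) 1) := by
    refine ⟨fun t s u => pushedBand (t / 2) (w * s) 0 - band (w' * u) 1, ?_, ?_, ?_, ?_, rfl, rfl⟩
    · exact (continuous_pushedBand (by fun_prop) (by fun_prop) (by fun_prop)).sub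
        (continuous_band (by fun_prop) (by fun_prop))
    · intro t ht s u
      rw [sub_ne_zero]
      rcases ht.1.eq_or_lt with h | h
      · rw [← h, zero_div, pushedBand_zero, band_zero, band_one]
        exact side₁_ne_side₂ _ _
      · exact pushedBand_ne_band (by linarith) (by linarith [ht.2]) (by simp) (by simp)
    · intro t s u
      beta_reduce
      rw [← pushedBand_add_int_mul_two_pi _ (w * s) _ w]
      ring_nf
    · intro t s u
      beta_reduce
      rw [← band_add_int_mul_two_pi (w' * u) _ w']
      ring_nf
  filter_upwards [h₁.eventually_curvature_eq, h₂.eventually_curvature_eq,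
    h₃.eventually_curvature_eq] with N e₁ e₂ e₃
  rw [e₁, e₂, ← e₃]
  simp only [zero_div, pushedBand_zero, band_zero, band_one]

/-- The Hopf band, parametrized by a compact annulus. -/
noncomputable def annulusBand (p : Circle × Set.Icc (0 : ℝ) 1) : Space3 :=
  !₂[p.2 - (p.1 : ℂ).re, (1 - p.2) * (p.1 : ℂ).im, p.2 * (p.1 : ℂ).im]

theorem annulusBand_exp (α : ℝ) (τ : Set.Icc (0 : ℝ) 1) :
    annulusBand (Circle.exp α, τ) = band α τ := by
  simp [annulusBand, band, Complex.exp_ofReal_mul_I_re, Complex.exp_ofReal_mul_I_im]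

/-- The annulus is compact. The embedding gives curves in the band continuous annulus coordinates,
to be lifted along `Circle.exp`. -/
theorem isClosedEmbedding_annulusBand : Topology.IsClosedEmbedding annulusBand := by
  apply Continuous.isClosedEmbedding
  · refine (PiLp.continuous_toLp 2 _).comp (continuous_pi fun i => ?_)
    have h1 : Continuous fun p : Circle × Set.Icc (0 : ℝ) 1 => (p.1 : ℂ).re :=
      Complex.continuous_re.comp (by fun_prop)
    have h2 : Continuous fun p : Circle × Set.Icc (0 : ℝ) 1 => (p.1 : ℂ).im :=
      Complex.continuous_im.comp (by fun_prop)
    fin_cases i <;> simp <;> fun_prop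
  · rintro ⟨ζ, τ⟩ ⟨ζ', τ'⟩ h
    have h0 := congrArg (fun v : Space3 => v 0) h
    have h1 := congrArg (fun v : Space3 => v 1) h
    have h2 := congrArg (fun v : Space3 => v 2) h
    simp only [annulusBand, Matrix.cons_val_zero, Matrix.cons_val_one, Matrix.cons_val]
      at h0 h1 h2
    have hz (ξ : Circle) : (ξ : ℂ).im ^ 2 + (ξ : ℂ).re ^ 2 = 1 := by
      have := Circle.normSq_coe ξ
      rw [Complex.normSq_apply] at this
      linarith
    obtain ⟨hC, hS, ht⟩ := band_coords_unique (hz ζ) (hz ζ') τ.2 τ'.2 h0 h1 h2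
    exact Prod.ext (Circle.ext (Complex.ext hC hS)) (Subtype.ext ht)

/-- A curve in the Hopf band lifts to the universal covering of the band. -/
theorem exists_band_lift {c : ℝ → Space3} (hc : Continuous c)
    (h : ∀ s, ∃ α τ, τ ∈ Set.Icc (0 : ℝ) 1 ∧ c s = band α τ) :
    ∃ α τ : ℝ → ℝ, Continuous α ∧ Continuous τ ∧ (∀ s, τ s ∈ Set.Icc (0 : ℝ) 1) ∧
      ∀ s, c s = band (α s) (τ s) := by
  have hex : ∀ s, ∃ p, annulusBand p = c s := fun s => by
    obtain ⟨α, τ, hτ, e⟩ := h s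
    exact ⟨(Circle.exp α, ⟨τ, hτ⟩), by rw [annulusBand_exp, e]⟩
  choose p hp using hex
  have hpc : Continuous p := by
    rw [isClosedEmbedding_annulusBand.isEmbedding.continuous_iff]
    exact hc.congr fun s => (hp s).symm
  obtain ⟨e₀, he₀⟩ := Circle.exp_surjective (p 0).1
  obtain ⟨A, ⟨-, hA⟩, -⟩ := Circle.isCoveringMap_exp.existsUnique_continuousMap_lifts
    (⟨fun s => (p s).1, continuous_fst.comp hpc⟩ : C(ℝ, Circle)) 0 e₀ he₀
  refine ⟨A, fun s => (p s).2, A.continuous,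
    continuous_subtype_val.comp (continuous_snd.comp hpc), fun s => (p s).2.2, fun s => ?_⟩
  rw [← annulusBand_exp, ← hp s]
  congr 1
  exact Prod.ext (congrFun hA s).symm rfl

/-- The lift of a loop in the Hopf band winds around the band an integral number of times. -/
theorem exists_winding {α τ : ℝ → ℝ} (hα : Continuous α) (hτI : ∀ s, τ s ∈ Set.Icc (0 : ℝ) 1)
    (h : ∀ s, band (α (s + 2 * Real.pi)) (τ (s + 2 * Real.pi)) = band (α s) (τ s)) :
    (∃ w : ℤ, ∀ s, α (s + 2 * Real.pi) = α s + w * (2 * Real.pi)) ∧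
      ∀ s, τ (s + 2 * Real.pi) = τ s := by
  refine ⟨?_, fun s => ((band_injective (hτI _) (hτI _) (h s)).2)⟩
  have hint (s : ℝ) : ∃ w : ℤ, (α (s + 2 * Real.pi) - α s) / (2 * Real.pi) = w := by
    obtain ⟨w, hw⟩ := (band_injective (hτI _) (hτI _) (h s).symm).1
    refine ⟨w, ?_⟩
    rw [hw]
    field_simp
    ring
  have hdisc : IsDiscrete (Set.range ((↑) : ℤ → ℝ)) :=
    (Int.isClosedEmbedding_coe_real.isEmbedding).isDiscrete_range
  obtain ⟨y, ⟨w, rfl⟩, hy⟩ := isPreconnected_univ.eqOn_const_of_mapsTo hdisc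
    (f := fun s => (α (s + 2 * Real.pi) - α s) / (2 * Real.pi)) (by fun_prop)
    (fun s _ => by
      obtain ⟨m, hm⟩ := hint s
      exact ⟨m, hm.symm⟩) ⟨_, ⟨0, rfl⟩⟩
  refine ⟨w, fun s => ?_⟩
  have := hy (Set.mem_univ s)
  simp only [Function.const] at this
  rw [div_eq_iff (by positivity)] at this
  linarith

end HopfLadder

/-! ### Curves in a ladder on the Hopf band -/

namespace HopfLadder

open Filter Topology

/-- The rung angles of a ladder with `n` rungs, in increasing order, repeated with period `2π`. -/
structure RungSystem (n : ℕ) where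
  angle : ℤ → ℝ
  strictMono : StrictMono angle
  angle_add : ∀ m, angle (m + n) = angle m + 2 * Real.pi

namespace RungSystem

variable {n : ℕ} (R : RungSystem n)

theorem angle_add_mul (m k : ℤ) : R.angle (m + k * n) = R.angle m + k * (2 * Real.pi) := by
  induction k with
  | zero => simp
  | succ i ih =>
    rw [show m + ((i : ℤ) + 1) * n = (m + i * n) + n by ring, R.angle_add, ih]
    push_cast
    ring
  | pred i ih =>
    have h := R.angle_add (m + (-(i : ℤ) - 1) * n)
    rw [show m + (-(i : ℤ) - 1) * n + n = m + -(i : ℤ) * n by ring, ih] at h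
    push_cast at h ⊢
    linarith

/-- The two sides and the rungs, as a subset of the Hopf band. -/
def ladder : Set Space3 :=
  {x | ∃ α τ, τ ∈ Set.Icc (0 : ℝ) 1 ∧ (τ = 0 ∨ τ = 1 ∨ α ∈ Set.range R.angle) ∧ x = band α τ}

/-- The end points of the rungs. -/
def vertices : Set Space3 :=
  {x | ∃ m τ, (τ = 0 ∨ τ = 1) ∧ x = band (R.angle m) τ}

theorem mem_Icc_of_end {τ : ℝ} (h : τ = 0 ∨ τ = 1) : τ ∈ Set.Icc (0 : ℝ) 1 := by
  rcases h with rfl | rfl <;> simp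

theorem add_mem_range_angle {α : ℝ} (h : α ∈ Set.range R.angle) (w : ℤ) :
    α + w * (2 * Real.pi) ∈ Set.range R.angle := by
  obtain ⟨m, rfl⟩ := h
  exact ⟨m + w * n, R.angle_add_mul m w⟩

theorem band_mem_ladder {α τ : ℝ} (hτ : τ ∈ Set.Icc (0 : ℝ) 1) :
    band α τ ∈ R.ladder ↔ τ = 0 ∨ τ = 1 ∨ α ∈ Set.range R.angle := by
  refine ⟨?_, fun h => ⟨α, τ, hτ, h, rfl⟩⟩
  rintro ⟨α', τ', hτ', h, e⟩
  obtain ⟨⟨w, hw⟩, rfl⟩ := band_injective hτ' hτ e.symm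
  rcases h with h | h | h
  · exact Or.inl h
  · exact Or.inr (Or.inl h)
  · exact Or.inr (Or.inr (hw ▸ R.add_mem_range_angle h w))

theorem band_mem_vertices {α τ : ℝ} (hτ : τ ∈ Set.Icc (0 : ℝ) 1) :
    band α τ ∈ R.vertices ↔ (τ = 0 ∨ τ = 1) ∧ α ∈ Set.range R.angle := by
  constructor
  · rintro ⟨m, τ', hτ', e⟩
    obtain ⟨⟨w, hw⟩, rfl⟩ := band_injective (mem_Icc_of_end hτ') hτ e.symm
    exact ⟨hτ', hw ▸ R.add_mem_range_angle ⟨m, rfl⟩ w⟩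
  · rintro ⟨h, m, rfl⟩
    exact ⟨m, τ, h, rfl⟩

theorem exists_angle_le_lt (hn : 0 < n) (α : ℝ) : ∃ m, R.angle m ≤ α ∧ α < R.angle (m + 1) := by
  have hπ := Real.two_pi_pos
  have hn' : (0 : ℤ) < n := by exact_mod_cast hn
  set q : ℤ := ⌊(α - R.angle 0) / (2 * Real.pi)⌋ with hq
  have h1 : R.angle (0 + q * n) ≤ α := by
    rw [R.angle_add_mul]
    have := Int.floor_le ((α - R.angle 0) / (2 * Real.pi))
    rw [le_div_iff₀ hπ] at this
    linarith
  have h2 : α < R.angle (0 + (q + 1) * n) := by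
    rw [R.angle_add_mul]
    have := Int.lt_floor_add_one ((α - R.angle 0) / (2 * Real.pi))
    rw [div_lt_iff₀ hπ] at this
    push_cast
    linarith
  obtain ⟨m, hm, hmax⟩ := Int.exists_greatest_of_bdd (P := fun m => R.angle m ≤ α)
    ⟨0 + (q + 1) * n, fun z hz => (R.strictMono.lt_iff_lt.1 (hz.trans_lt h2)).le⟩ ⟨_, h1⟩
  refine ⟨m, hm, ?_⟩
  by_contra hle
  have := hmax (m + 1) (not_lt.1 hle)
  omega

theorem notMem_range_of_between {m : ℤ} {α : ℝ} (h₁ : R.angle m < α) (h₂ : α < R.angle (m + 1)) :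
    α ∉ Set.range R.angle := by
  rintro ⟨k, rfl⟩
  have := R.strictMono.lt_iff_lt.1 h₁
  have := R.strictMono.lt_iff_lt.1 h₂
  omega

theorem isOpen_compl_range_angle (hn : 0 < n) : IsOpen (Set.range R.angle)ᶜ := by
  rw [isOpen_iff_mem_nhds]
  intro α hα
  obtain ⟨m, h₁, h₂⟩ := R.exists_angle_le_lt hn α
  have h₁' : R.angle m < α := lt_of_le_of_ne h₁ fun h => hα ⟨m, h⟩
  filter_upwards [Ioo_mem_nhds h₁' h₂] with β hβ
  exact R.notMem_range_of_between hβ.1 hβ.2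

theorem eventually_eq_of_mem_range (m : ℤ) :
    ∀ᶠ β in 𝓝 (R.angle m), β ∈ Set.range R.angle → β = R.angle m := by
  have h₁ : R.angle (m - 1) < R.angle m := R.strictMono (by omega)
  have h₂ : R.angle m < R.angle (m + 1) := R.strictMono (by omega)
  filter_upwards [Ioo_mem_nhds h₁ h₂] with β hβ
  rintro ⟨k, rfl⟩
  have := R.strictMono.lt_iff_lt.1 hβ.1
  have := R.strictMono.lt_iff_lt.1 hβ.2
  rw [show k = m by omega]

/-- A curve in the ladder that joins two vertices and meets no vertex in between either stays on a
rung, or runs on one side from a vertex to one of its neighbours or back to itself. -/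
theorem edge_path (hn : 0 < n) {α τ : ℝ → ℝ} {s₀ s₁ : ℝ} {m₀ m₁ : ℤ} (hs : s₀ < s₁)
    (hα : Continuous α) (hτ : Continuous τ) (hτI : ∀ s, τ s ∈ Set.Icc (0 : ℝ) 1)
    (hmem : ∀ s ∈ Set.Ioo s₀ s₁, band (α s) (τ s) ∈ R.ladder \ R.vertices)
    (h₀ : α s₀ = R.angle m₀) (h₁ : α s₁ = R.angle m₁) (hτ₀ : τ s₀ = 0 ∨ τ s₀ = 1)
    (hτ₁ : τ s₁ = 0 ∨ τ s₁ = 1) :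
    m₁ = m₀ ∨ (m₁ = m₀ + 1 ∨ m₁ = m₀ - 1) ∧ τ s₁ = τ s₀ := by
  have hivt (x : ℝ) (hx : x ∈ Set.Ioo (α s₀) (α s₁) ∪ Set.Ioo (α s₁) (α s₀)) :
      ∃ s ∈ Set.Ioo s₀ s₁, α s = x := by
    rcases hx with hx | hx
    · exact intermediate_value_Ioo hs.le hα.continuousOn hx
    · exact intermediate_value_Ioo' hs.le hα.continuousOn hx
  -- Without its vertices the ladder is a disjoint union of two relatively open pieces, the open
  -- side arcs and the open rungs; a connected curve stays in one.
  have hsplit : Set.Ioo s₀ s₁ ⊆ {s | α s ∉ Set.range R.angle} ∨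
      Set.Ioo s₀ s₁ ⊆ {s | τ s ∈ Set.Ioo (0 : ℝ) 1} := by
    refine isPreconnected_iff_subset_of_disjoint.1 isPreconnected_Ioo _ _
      ((R.isOpen_compl_range_angle hn).preimage hα) (isOpen_Ioo.preimage hτ) ?_ ?_
    · intro s hs'
      have h := (hmem s hs').2
      rw [R.band_mem_vertices (hτI s)] at h
      by_cases hc : α s ∈ Set.range R.angle
      · refine Or.inr ⟨lt_of_le_of_ne (hτI s).1 ?_, lt_of_le_of_ne (hτI s).2 ?_⟩
        · exact fun e => h ⟨Or.inl e.symm, hc⟩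
        · exact fun e => h ⟨Or.inr e, hc⟩
      · exact Or.inl hc
    · rw [Set.eq_empty_iff_forall_notMem]
      rintro s ⟨hs', hc, ht⟩
      rcases (R.band_mem_ladder (hτI s)).1 (hmem s hs').1 with h | h | h
      · exact ht.1.ne' h
      · exact ht.2.ne h
      · exact hc h
  rcases hsplit with hside | hrung
  · have hτeq : τ s₁ = τ s₀ := by
      by_contra hne
      obtain ⟨s, hs', hval⟩ : ∃ s ∈ Set.Ioo s₀ s₁, τ s = 1 / 2 := by
        rcases hτ₀ with h | h <;> rcases hτ₁ with h' | h'
        · exact absurd (h'.trans h.symm) hne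
        · exact intermediate_value_Ioo hs.le hτ.continuousOn (by rw [h, h']; norm_num)
        · exact intermediate_value_Ioo' hs.le hτ.continuousOn (by rw [h, h']; norm_num)
        · exact absurd (h'.trans h.symm) hne
      rcases (R.band_mem_ladder (hτI s)).1 (hmem s hs').1 with h | h | h
      · rw [hval] at h; norm_num at h
      · rw [hval] at h; norm_num at h
      · exact hside hs' h
    have hnot (k : ℤ) : ¬ (m₀ < k ∧ k < m₁ ∨ m₁ < k ∧ k < m₀) := by
      intro hk
      obtain ⟨s, hs', e⟩ := hivt (R.angle k) (by
        rw [h₀, h₁]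
        rcases hk with hk | hk
        · exact Or.inl ⟨R.strictMono hk.1, R.strictMono hk.2⟩
        · exact Or.inr ⟨R.strictMono hk.1, R.strictMono hk.2⟩)
      exact hside hs' ⟨k, e.symm⟩
    have k1 := hnot (m₀ + 1)
    have k2 := hnot (m₀ - 1)
    by_cases h : m₁ = m₀
    · exact Or.inl h
    · exact Or.inr ⟨by omega, hτeq⟩
  · left
    by_contra hne
    -- To change rungs, the curve would pass an angle `x` strictly between two consecutive rungs,
    -- away from the sides.
    obtain ⟨k, x, hx₁, hx₂, hx⟩ : ∃ (k : ℤ) (x : ℝ), R.angle k < x ∧ x < R.angle (k + 1) ∧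
        x ∈ Set.Ioo (α s₀) (α s₁) ∪ Set.Ioo (α s₁) (α s₀) := by
      rcases lt_or_gt_of_ne hne with h | h
      · obtain ⟨x, hx₁, hx₂⟩ := exists_between (R.strictMono (show m₁ < m₁ + 1 by omega))
        refine ⟨m₁, x, hx₁, hx₂, Or.inr ⟨h₁ ▸ hx₁, hx₂.trans_le ?_⟩⟩
        rw [h₀]
        exact R.strictMono.monotone (by omega)
      · obtain ⟨x, hx₁, hx₂⟩ := exists_between (R.strictMono (show m₀ < m₀ + 1 by omega))
        refine ⟨m₀, x, hx₁, hx₂, Or.inl ⟨h₀ ▸ hx₁, hx₂.trans_le ?_⟩⟩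
        rw [h₁]
        exact R.strictMono.monotone (by omega)
    obtain ⟨s, hs', e⟩ := hivt x hx
    rcases (R.band_mem_ladder (hτI s)).1 (hmem s hs').1 with h | h | h
    · exact (hrung hs').1.ne' h
    · exact (hrung hs').2.ne h
    · exact R.notMem_range_of_between hx₁ hx₂ (e ▸ h)

end RungSystem

/-- `x` is the centre of a tripod in `X`. -/
def IsBranchPoint (X : Set Space3) (x : Space3) : Prop :=
  ∃ p : Fin 3 → ℝ → Space3, (∀ i, Continuous (p i)) ∧ (∀ i, p i 0 = x) ∧
    (∀ i, ∀ t ∈ Set.Icc (0 : ℝ) 1, p i t ∈ X) ∧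
    (∀ i, ∀ t ∈ Set.Ioc (0 : ℝ) 1, p i t ≠ x) ∧
    (∀ i j, i ≠ j → ∀ t ∈ Set.Ioc (0 : ℝ) 1, ∀ t' ∈ Set.Ioc (0 : ℝ) 1, p i t ≠ p j t')

theorem IsBranchPoint.image {X : Set Space3} {x : Space3} (h : IsBranchPoint X x)
    {f : Space3 → Space3} (hf : Continuous f) (hinj : Function.Injective f)
    (hX : Set.MapsTo f X X) : IsBranchPoint X (f x) := by
  obtain ⟨p, hc, h0, hm, hne, hd⟩ := h
  exact ⟨fun i t => f (p i t), fun i => hf.comp (hc i), fun i => congrArg f (h0 i),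
    fun i t ht => hX (hm i t ht), fun i t ht e => hne i t ht (hinj e),
    fun i j hij t ht t' ht' e => hd i j hij t ht t' ht' (hinj e)⟩

/-- There is no tripod in the real line. -/
theorem not_tripod_real {g : Fin 3 → ℝ → ℝ} {c ε : ℝ} (hε : 0 < ε) (hg : ∀ i, Continuous (g i))
    (h0 : ∀ i, g i 0 = c) (hne : ∀ i, ∀ t ∈ Set.Ioc 0 ε, g i t ≠ c)
    (hd : ∀ i j, i ≠ j → ∀ t ∈ Set.Ioc 0 ε, ∀ t' ∈ Set.Ioc 0 ε, g i t ≠ g j t') : False := by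
  have hεm : ε ∈ Set.Ioc 0 ε := ⟨hε, le_rfl⟩
  have up (i j : Fin 3) (hij : i ≠ j) (hi : c < g i ε) (hle : g i ε ≤ g j ε) : False := by
    obtain ⟨t, ht, e⟩ := intermediate_value_Ioc hε.le (hg j).continuousOn
      (show g i ε ∈ Set.Ioc (g j 0) (g j ε) from ⟨by rwa [h0], hle⟩)
    exact hd i j hij ε hεm t ht e.symm
  have down (i j : Fin 3) (hij : i ≠ j) (hi : g i ε < c) (hle : g j ε ≤ g i ε) : False := by
    obtain ⟨t, ht, e⟩ := intermediate_value_Ioc' hε.le (hg j).continuousOn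
      (show g i ε ∈ Set.Ico (g j ε) (g j 0) from ⟨hle, by rwa [h0]⟩)
    exact hd i j hij ε hεm t ht e.symm
  have same (i j : Fin 3) (hij : i ≠ j) (h : c < g i ε ↔ c < g j ε) : False := by
    rcases lt_or_gt_of_ne (hne i ε hεm) with hi | hi
    · have hj : g j ε < c :=
        lt_of_le_of_ne (not_lt.1 fun hj => hi.not_gt (h.2 hj)) (hne j ε hεm)
      rcases le_total (g i ε) (g j ε) with hle | hle
      · exact down j i hij.symm hj hle
      · exact down i j hij hi hle
    · rcases le_total (g i ε) (g j ε) with hle | hle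
      · exact up i j hij hi hle
      · exact up j i hij.symm (h.1 hi) hle
  have h01 := same 0 1 (by decide)
  have h02 := same 0 2 (by decide)
  have h12 := same 1 2 (by decide)
  tauto

/-! ### The vertices of a ladder are its branch points. -/

namespace RungSystem

variable {n : ℕ} (R : RungSystem n)

/-- The arms run both ways along the side and across the rung. Those on the side have angular length
one, too short to meet around the circle. -/
theorem isBranchPoint_of_mem_vertices {x : Space3} (hx : x ∈ R.vertices) :
    IsBranchPoint R.ladder x := by
  obtain ⟨m, τ, hτ, rfl⟩ := hx
  have hτI := mem_Icc_of_end hτ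
  have hπ := Real.pi_gt_three
  let σ : ℝ → ℝ := fun t => (1 - t) * τ + t * (1 - τ)
  have hσ : ∀ t ∈ Set.Icc (0 : ℝ) 1, σ t ∈ Set.Icc (0 : ℝ) 1 := by
    intro t ht
    have := ht.1; have := ht.2
    rcases hτ with rfl | rfl <;> simp only [σ] <;> constructor <;> linarith
  have hσne : ∀ t ∈ Set.Ioc (0 : ℝ) 1, σ t ≠ τ := by
    intro t ht e
    have := ht.1
    rcases hτ with rfl | rfl <;> simp only [σ] at e <;> linarith
  have hangle {a b : ℝ} (h : band (R.angle m + a) τ = band (R.angle m + b) τ) (hab : |a - b| ≤ 2) :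
      a = b := by
    obtain ⟨⟨w, hw⟩, -⟩ := band_injective hτI hτI h
    have hw' : b - a = w * (2 * Real.pi) := by linarith
    rw [abs_le] at hab
    have hw0 : w = 0 := by
      have h1 : (w : ℝ) < 1 := by nlinarith
      have h2 : (-1 : ℝ) < w := by nlinarith
      have h1' : w < 1 := by exact_mod_cast h1
      have h2' : -1 < w := by exact_mod_cast h2
      omega
    rw [hw0] at hw'
    norm_num at hw'
    linarith
  have hbase : band (R.angle m) τ = band (R.angle m + 0) τ := by rw [add_zero]
  have hIcc {t : ℝ} (ht : t ∈ Set.Ioc (0 : ℝ) 1) : t ∈ Set.Icc (0 : ℝ) 1 := ⟨ht.1.le, ht.2⟩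
  have d01 : ∀ t ∈ Set.Ioc (0 : ℝ) 1, ∀ t' ∈ Set.Ioc (0 : ℝ) 1,
      band (R.angle m + t) τ ≠ band (R.angle m + -t') τ := by
    intro t ht t' ht' e
    have := hangle e (by rw [abs_le]; constructor <;> linarith [ht.1, ht.2, ht'.1, ht'.2])
    linarith [ht.1, ht'.1]
  have d2 : ∀ a : ℝ, ∀ t ∈ Set.Ioc (0 : ℝ) 1, band a τ ≠ band (R.angle m) (σ t) := by
    intro a t ht e
    exact hσne t ht (band_injective hτI (hσ t (hIcc ht)) e).2.symm
  refine ⟨![fun t => band (R.angle m + t) τ, fun t => band (R.angle m + -t) τ,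
    fun t => band (R.angle m) (σ t)], ?_, ?_, ?_, ?_, ?_⟩
  · intro i
    fin_cases i
    · exact continuous_band (by fun_prop) (by fun_prop)
    · exact continuous_band (by fun_prop) (by fun_prop)
    · exact continuous_band (by fun_prop) (by fun_prop)
  · intro i
    fin_cases i <;> simp [σ]
  · intro i t ht
    fin_cases i
    · exact (R.band_mem_ladder hτI).2 (by tauto)
    · exact (R.band_mem_ladder hτI).2 (by tauto)
    · exact (R.band_mem_ladder (hσ t ht)).2 (Or.inr (Or.inr ⟨m, rfl⟩))
  · intro i t ht
    fin_cases i
    · intro e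
      have := hangle (e.trans hbase) (by rw [abs_le]; constructor <;> linarith [ht.1, ht.2])
      exact ht.1.ne' this
    · intro e
      have := hangle (e.trans hbase) (by rw [abs_le]; constructor <;> linarith [ht.1, ht.2])
      linarith [ht.1]
    · exact (d2 _ t ht).symm
  · intro i j hij t ht t' ht'
    fin_cases i <;> fin_cases j
    · exact absurd rfl hij
    · exact d01 t ht t' ht'
    · exact d2 _ t' ht'
    · exact (d01 t' ht' t ht).symm
    · exact absurd rfl hij
    · exact d2 _ t' ht'
    · exact (d2 _ t ht).symm
    · exact (d2 _ t ht).symm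
    · exact absurd rfl hij

/-- Near any other point the ladder is an arc of a side or of a rung, so one band coordinate would
turn the tripod into a tripod in the real line. -/
theorem mem_vertices_of_isBranchPoint (hn : 0 < n) {x : Space3} (h : IsBranchPoint R.ladder x) :
    x ∈ R.vertices := by
  obtain ⟨p, hc, h0, hm, hne, hd⟩ := h
  have hx : x ∈ R.ladder := h0 0 ▸ hm 0 0 (by simp)
  obtain ⟨α, τ, hτ, hατ, rfl⟩ := hx
  by_contra hv
  rw [R.band_mem_vertices hτ, not_and_or] at hv
  have hlift (i : Fin 3) : ∃ A T : ℝ → ℝ, Continuous A ∧ Continuous T ∧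
      (∀ s, T s ∈ Set.Icc (0 : ℝ) 1) ∧ A 0 = α ∧ T 0 = τ ∧
      ∀ s ∈ Set.Icc (0 : ℝ) 1, p i s = band (A s) (T s) := by
    obtain ⟨A, T, hA, hT, hTI, e⟩ := exists_band_lift
      (c := fun s => p i (Set.projIcc (0 : ℝ) 1 zero_le_one s))
      ((hc i).comp (continuous_subtype_val.comp continuous_projIcc)) (fun s => by
        obtain ⟨a, b, hb, -, e⟩ := hm i _ (Set.projIcc (0 : ℝ) 1 zero_le_one s).2
        exact ⟨a, b, hb, e⟩)
    have e' : ∀ s ∈ Set.Icc (0 : ℝ) 1, p i s = band (A s) (T s) := fun s hs => by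
      rw [← e s, Set.projIcc_of_mem zero_le_one hs]
    have e0 := (h0 i).symm.trans (e' 0 (by simp))
    obtain ⟨⟨w, hw⟩, ht⟩ := band_injective hτ (hTI 0) e0
    refine ⟨fun s => A s + ((-w : ℤ) : ℝ) * (2 * Real.pi), T, by fun_prop, hT, hTI, ?_, ht.symm, ?_⟩
    · simp only
      rw [hw]
      push_cast
      ring
    · intro s hs
      rw [band_add_int_mul_two_pi, e' s hs]
  choose A T hA hT hTI hA0 hT0 hp using hlift
  by_cases hmid : τ = 0 ∨ τ = 1
  · have hα : α ∉ Set.range R.angle := by tauto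
    -- Avoiding rung angles keeps the arms on the sides, and the bound `1` keeps them off the
    -- opposite side.
    have hev : ∀ᶠ s in 𝓝 (0 : ℝ), ∀ i, A i s ∉ Set.range R.angle ∧ |T i s - τ| < 1 := by
      rw [eventually_all]
      intro i
      refine (((hA i).tendsto 0).eventually (p := fun a => a ∉ Set.range R.angle) ?_).and ?_
      · rw [hA0]
        exact (R.isOpen_compl_range_angle hn).mem_nhds hα
      · have : Continuous fun s => |T i s - τ| := by fun_prop
        refine (this.tendsto 0).eventually (gt_mem_nhds ?_)
        rw [hT0]
        simp
    obtain ⟨ε, hε, hball⟩ := Metric.eventually_nhds_iff.1 hev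
    have hδ : ∀ t ∈ Set.Ioc (0 : ℝ) (min (ε / 2) 1), t ∈ Set.Ioc (0 : ℝ) 1 ∧
        ∀ i, p i t = band (A i t) τ := by
      intro t ht
      have ht1 : t ∈ Set.Ioc (0 : ℝ) 1 := ⟨ht.1, ht.2.trans (min_le_right _ _)⟩
      have htε : t < ε := by linarith [ht.2.trans (min_le_left _ _)]
      refine ⟨ht1, fun i => ?_⟩
      have hb := hball (y := t) (by rw [Real.dist_eq, sub_zero, abs_of_pos ht.1]; exact htε) i
      have hpt := hp i t ⟨ht1.1.le, ht1.2⟩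
      have hl := hm i t ⟨ht1.1.le, ht1.2⟩
      rw [hpt, R.band_mem_ladder (hTI i t)] at hl
      have hTt : T i t = τ := by
        have hab := abs_lt.1 hb.2
        rcases hl with h | h | h
        · rcases hmid with h' | h'
          · rw [h, h']
          · linarith
        · rcases hmid with h' | h'
          · linarith
          · rw [h, h']
        · exact absurd h hb.1
      rw [hpt, hTt]
    refine not_tripod_real (g := A) (c := α) (lt_min (half_pos hε) one_pos) hA hA0 ?_ ?_
    · intro i t ht e
      exact hne i t (hδ t ht).1 (by rw [(hδ t ht).2 i, e])
    · intro i j hij t ht t' ht' e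
      exact hd i j hij t (hδ t ht).1 t' (hδ t' ht').1 (by rw [(hδ t ht).2 i, (hδ t' ht').2 j, e])
  · have hα : α ∈ Set.range R.angle := by tauto
    obtain ⟨m, rfl⟩ := hα
    have hτ' : τ ∈ Set.Ioo (0 : ℝ) 1 :=
      ⟨lt_of_le_of_ne hτ.1 fun e => hmid (Or.inl e.symm),
        lt_of_le_of_ne hτ.2 fun e => hmid (Or.inr e)⟩
    have hev : ∀ᶠ s in 𝓝 (0 : ℝ), ∀ i,
        (A i s ∈ Set.range R.angle → A i s = R.angle m) ∧ T i s ∈ Set.Ioo (0 : ℝ) 1 := by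
      rw [eventually_all]
      intro i
      refine (((hA i).tendsto 0).eventually
        (p := fun a => a ∈ Set.range R.angle → a = R.angle m) ?_).and
        (((hT i).tendsto 0).eventually (p := fun b => b ∈ Set.Ioo (0 : ℝ) 1) ?_)
      · rw [hA0]
        exact R.eventually_eq_of_mem_range m
      · rw [hT0]
        exact isOpen_Ioo.mem_nhds hτ'
    obtain ⟨ε, hε, hball⟩ := Metric.eventually_nhds_iff.1 hev
    have hδ : ∀ t ∈ Set.Ioc (0 : ℝ) (min (ε / 2) 1), t ∈ Set.Ioc (0 : ℝ) 1 ∧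
        ∀ i, p i t = band (R.angle m) (T i t) := by
      intro t ht
      have ht1 : t ∈ Set.Ioc (0 : ℝ) 1 := ⟨ht.1, ht.2.trans (min_le_right _ _)⟩
      have htε : t < ε := by linarith [ht.2.trans (min_le_left _ _)]
      refine ⟨ht1, fun i => ?_⟩
      have hb := hball (y := t) (by rw [Real.dist_eq, sub_zero, abs_of_pos ht.1]; exact htε) i
      have hpt := hp i t ⟨ht1.1.le, ht1.2⟩
      have hl := hm i t ⟨ht1.1.le, ht1.2⟩
      rw [hpt, R.band_mem_ladder (hTI i t)] at hl
      rcases hl with h | h | h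
      · exact absurd h hb.2.1.ne'
      · exact absurd h hb.2.2.ne
      · rw [hpt, hb.1 h]
    refine not_tripod_real (g := T) (c := τ) (lt_min (half_pos hε) one_pos) hT hT0 ?_ ?_
    · intro i t ht e
      exact hne i t (hδ t ht).1 (by rw [(hδ t ht).2 i, e])
    · intro i j hij t ht t' ht' e
      exact hd i j hij t (hδ t ht).1 t' (hδ t' ht').1 (by rw [(hδ t ht).2 i, (hδ t' ht').2 j, e])

end RungSystem

end HopfLadder

/-! ### Symmetries of a ladder wind its two sides in the same way -/

namespace HopfLadder

open Filter Topology

theorem abs_sub_le_of_steps {m : ℤ → ℤ} (hstep : ∀ i, |m (i + 1) - m i| ≤ 1) (i : ℤ) (k : ℕ) :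
    |m (i + k) - m i| ≤ k := by
  induction k with
  | zero => simp
  | succ k ih =>
    have h := hstep (i + k)
    rw [abs_le] at *
    push_cast
    rw [← add_assoc]
    constructor <;> linarith [h.1, h.2, ih.1, ih.2]

/-- A sequence with steps at most one that advances by a nonzero multiple of `n` in `n` steps
advances by the same unit in each step. -/
theorem steps_eq_of_winding {n : ℕ} (hn : 0 < n) {m : ℤ → ℤ} {w : ℤ} (hw : w ≠ 0)
    (hstep : ∀ i, |m (i + 1) - m i| ≤ 1) (hper : ∀ i, m (i + n) = m i + w * n) :
    (w = 1 ∨ w = -1) ∧ ∀ i, m (i + 1) = m i + w := by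
  have hn' : (0 : ℤ) < n := by exact_mod_cast hn
  have hw1 : w = 1 ∨ w = -1 := by
    have h := abs_le.1 (abs_sub_le_of_steps hstep 0 n)
    rw [hper] at h
    have h1 : w ≤ 1 := by nlinarith [h.2]
    have h2 : -1 ≤ w := by nlinarith [h.1]
    omega
  refine ⟨hw1, fun i => ?_⟩
  -- The other `n - 1` steps advance by at most `n - 1`, so this step must contribute its full unit.
  have h := abs_le.1 (abs_sub_le_of_steps hstep (i + 1) (n - 1))
  rw [show i + 1 + ((n - 1 : ℕ) : ℤ) = i + n by push_cast [Nat.cast_sub hn]; ring, hper] at h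
  have hs := abs_le.1 (hstep i)
  rcases hw1 with rfl | rfl
  · omega
  · omega

namespace RungSystem

variable {n : ℕ} (R : RungSystem n)

theorem angle_injective : Function.Injective R.angle := R.strictMono.injective

/-- The lift of the image of a side of the ladder under a map that preserves vertices. -/
theorem side_lift_steps (hn : 0 < n) {f : Space3 → Space3}
    (hfX : ∀ x ∈ R.ladder, f x ∈ R.ladder)
    (hfV : ∀ x ∈ R.ladder, (f x ∈ R.vertices ↔ x ∈ R.vertices))
    {α τ : ℝ → ℝ} {e : ℝ} {w : ℤ} (he : e = 0 ∨ e = 1) (hα : Continuous α) (hτ : Continuous τ)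
    (hτI : ∀ s, τ s ∈ Set.Icc (0 : ℝ) 1)
    (hp : ∀ s, α (s + 2 * Real.pi) = α s + w * (2 * Real.pi))
    (hf : ∀ s, f (band s e) = band (α s) (τ s)) (hw : w ≠ 0) :
    ∃ (m : ℤ) (e' : ℝ), (w = 1 ∨ w = -1) ∧ (e' = 0 ∨ e' = 1) ∧
      ∀ i : ℤ, f (band (R.angle i) e) = band (R.angle (m + w * i)) e' := by
  have heI := mem_Icc_of_end he
  have hX (s : ℝ) : band s e ∈ R.ladder := (R.band_mem_ladder heI).2 (by tauto)
  have hvert (i : ℤ) : ∃ k, α (R.angle i) = R.angle k ∧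
      (τ (R.angle i) = 0 ∨ τ (R.angle i) = 1) := by
    have h := (hfV _ (hX (R.angle i))).2 ⟨i, e, he, rfl⟩
    rw [hf, R.band_mem_vertices (hτI _)] at h
    obtain ⟨h1, k, hk⟩ := h
    exact ⟨k, hk.symm, h1⟩
  choose m hm hτv using hvert
  have hedge (i : ℤ) := R.edge_path hn (R.strictMono (show i < i + 1 by omega)) hα hτ hτI
    (fun s hs => by
      rw [← hf]
      refine ⟨hfX _ (hX s), fun hv => ?_⟩
      rw [hfV _ (hX s), R.band_mem_vertices heI] at hv
      exact R.notMem_range_of_between hs.1 hs.2 hv.2) (hm i) (hm (i + 1)) (hτv i) (hτv (i + 1))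
  have hstep (i : ℤ) : |m (i + 1) - m i| ≤ 1 := by
    rw [abs_le]
    rcases hedge i with h | ⟨h | h, -⟩ <;> omega
  have hper (i : ℤ) : m (i + n) = m i + w * n := by
    apply R.angle_injective
    rw [← hm, R.angle_add, hp, hm, R.angle_add_mul]
  obtain ⟨hw1, hall⟩ := steps_eq_of_winding hn hw hstep hper
  have hτs (i : ℤ) : τ (R.angle (i + 1)) = τ (R.angle i) := by
    rcases hedge i with h | h
    · have := hall i
      omega
    · exact h.2
  have hmi (i : ℤ) : m i = m 0 + w * i ∧ τ (R.angle i) = τ (R.angle 0) := by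
    induction i with
    | zero => simp
    | succ k ih =>
      refine ⟨?_, (hτs k).trans ih.2⟩
      rw [hall, ih.1]
      ring
    | pred k ih =>
      have h1 := hall (-(k : ℤ) - 1)
      have h2 := hτs (-(k : ℤ) - 1)
      rw [sub_add_cancel] at h1 h2
      refine ⟨?_, h2.symm.trans ih.2⟩
      have := ih.1
      rw [h1] at this
      linear_combination this
  refine ⟨m 0, τ (R.angle 0), hw1, hτv 0, fun i => ?_⟩
  rw [hf, hm, (hmi i).1, (hmi i).2]

/-- A symmetry of a ladder with at least three rungs winds both sides of the ladder around the band
in the same direction, unless one of them does not wind around it at all. -/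
theorem winding_eq (hn : 3 ≤ n) {f : Space3 → Space3} (hfc : Continuous f)
    (hinj : Function.Injective f) (hfX : ∀ x ∈ R.ladder, f x ∈ R.ladder)
    (hfV : ∀ x ∈ R.ladder, (f x ∈ R.vertices ↔ x ∈ R.vertices))
    {α τ α' τ' : ℝ → ℝ} {w w' : ℤ} (hα : Continuous α) (hτ : Continuous τ) (hα' : Continuous α')
    (hτ' : Continuous τ') (hτI : ∀ s, τ s ∈ Set.Icc (0 : ℝ) 1)
    (hτI' : ∀ s, τ' s ∈ Set.Icc (0 : ℝ) 1)
    (hp : ∀ s, α (s + 2 * Real.pi) = α s + w * (2 * Real.pi))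
    (hp' : ∀ s, α' (s + 2 * Real.pi) = α' s + w' * (2 * Real.pi))
    (hf : ∀ s, f (band s 0) = band (α s) (τ s)) (hf' : ∀ s, f (band s 1) = band (α' s) (τ' s)) :
    w = 0 ∨ w' = 0 ∨ w = w' ∧ (w = 1 ∨ w = -1) := by
  by_cases hw : w = 0
  · exact Or.inl hw
  by_cases hw' : w' = 0
  · exact Or.inr (Or.inl hw')
  refine Or.inr (Or.inr ?_)
  have hn0 : 0 < n := by omega
  obtain ⟨m, e, hw1, he, hm⟩ :=
    R.side_lift_steps hn0 hfX hfV (Or.inl rfl) hα hτ hτI hp hf hw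
  obtain ⟨m', e', hw1', he', hm'⟩ :=
    R.side_lift_steps hn0 hfX hfV (Or.inr rfl) hα' hτ' hτI' hp' hf' hw'
  have hee : e ≠ e' := by
    rintro rfl
    -- As `w * w = 1`, this index is sent to `m'`: images on the same side would share a vertex.
    have h := hm (w * (m' - m))
    rw [show m + w * (w * (m' - m)) = m' + w' * 0 by
      have : w * w = 1 := by rcases hw1 with h | h <;> rw [h] <;> norm_num
      linear_combination (m' - m) * this, ← hm' 0] at h
    have := (band_injective (by simp) (by simp) (hinj h)).2
    norm_num at this
  -- The image of a rung joins vertices on different sides, so `edge_path` makes it stay at one rung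
  -- angle, up to full turns.
  have hrung (i : ℤ) : ∃ k : ℤ, m' + w' * i = m + w * i + k * n := by
    have hmemI (s : ℝ) := (Set.projIcc (0 : ℝ) 1 zero_le_one s).2
    have hmemX (s : ℝ) : band (R.angle i) (Set.projIcc (0 : ℝ) 1 zero_le_one s) ∈ R.ladder :=
      (R.band_mem_ladder (hmemI s)).2 (Or.inr (Or.inr ⟨i, rfl⟩))
    obtain ⟨A, T, hA, hT, hTI, hc⟩ := exists_band_lift
      (c := fun s => f (band (R.angle i) (Set.projIcc (0 : ℝ) 1 zero_le_one s)))
      (hfc.comp (continuous_band continuous_const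
        (continuous_subtype_val.comp continuous_projIcc))) (fun s => by
          obtain ⟨a, b, hb, -, e⟩ := hfX _ (hmemX s)
          exact ⟨a, b, hb, e⟩)
    have hc0 : f (band (R.angle i) 0) = band (A 0) (T 0) := by
      rw [← hc, Set.projIcc_left]
    have hc1 : f (band (R.angle i) 1) = band (A 1) (T 1) := by
      rw [← hc, Set.projIcc_right]
    rw [hm] at hc0
    rw [hm'] at hc1
    obtain ⟨⟨k, hk⟩, ht0⟩ := band_injective (mem_Icc_of_end he) (hTI 0) hc0
    obtain ⟨⟨k', hk'⟩, ht1⟩ := band_injective (mem_Icc_of_end he') (hTI 1) hc1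
    rw [← R.angle_add_mul] at hk hk'
    have := R.edge_path hn0 zero_lt_one hA hT hTI (fun s hs => by
      rw [← hc]
      refine ⟨hfX _ (hmemX s), fun hv => ?_⟩
      rw [hfV _ (hmemX s), R.band_mem_vertices (hmemI s),
        Set.projIcc_of_mem zero_le_one ⟨hs.1.le, hs.2.le⟩] at hv
      rcases hv.1 with h | h
      · exact hs.1.ne' h
      · exact hs.2.ne h) hk hk' (ht0 ▸ he) (ht1 ▸ he')
    rcases this with h | ⟨-, h⟩
    · exact ⟨k - k', by linear_combination h⟩
    · exact absurd (ht0.trans (h.symm.trans ht1.symm)) hee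
  obtain ⟨k₀, h₀⟩ := hrung 0
  obtain ⟨k₁, h₁⟩ := hrung 1
  have hdvd : (n : ℤ) ∣ w' - w := ⟨k₁ - k₀, by linear_combination h₁ - h₀⟩
  -- Both windings are `±1`, so they differ by at most two, less than `n`. This is where three rungs
  -- are needed.
  have hzero : w' - w = 0 := by
    apply Int.eq_zero_of_abs_lt_dvd hdvd
    have : (3 : ℤ) ≤ n := by exact_mod_cast hn
    rw [abs_lt]
    omega
  exact ⟨by omega, hw1⟩

end RungSystem

/-- The offset of the angle of the `k`-th rung in cyclic order, for `0 ≤ k < n`. -/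
noncomputable def sortedAngle (n : ℕ) (k : ℤ) : ℝ :=
  if k < ((n + 1) / 2 : ℕ) then k / n else Real.pi + (k - ((n + 1) / 2 : ℕ)) / n

/-- The rung angles of the standard ladder, in increasing order. -/
noncomputable def standardRungs (n : ℕ) (hn : 0 < n) : RungSystem n where
  angle m := sortedAngle n (m % n) + (m / n : ℤ) * (2 * Real.pi)
  strictMono := by
    have hn' : (0 : ℤ) < n := by exact_mod_cast hn
    have hnr : (0 : ℝ) < n := by exact_mod_cast hn
    have hπ := Real.pi_gt_three
    apply strictMono_int_of_lt_succ
    intro m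
    have h0 := Int.emod_nonneg m hn'.ne'
    have h1 := Int.emod_lt_of_pos m hn'
    have hdm := Int.emod_add_mul_ediv m n
    generalize m % (n : ℤ) = r at *
    generalize m / (n : ℤ) = q at *
    subst hdm
    have hEn : (((n + 1) / 2 : ℕ) : ℤ) ≤ n := by omega
    have hE1 : 1 ≤ (((n + 1) / 2 : ℕ) : ℤ) := by omega
    have hE1' : (1 : ℝ) ≤ (((n + 1) / 2 : ℕ) : ℝ) := by exact_mod_cast hE1
    have hlt1 {x : ℤ} (hx : x < n) : (x : ℝ) / n < 1 := by
      rw [div_lt_one hnr]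
      exact_mod_cast hx
    have hlt1' {x : ℤ} (hx : x < n) : ((x : ℝ) - (((n + 1) / 2 : ℕ) : ℝ)) / n < 1 := by
      rw [div_lt_one hnr]
      have : (x : ℝ) < n := by exact_mod_cast hx
      linarith
    by_cases hlast : r + 1 < n
    · have e1 : (r + n * q + 1) % (n : ℤ) = r + 1 := by
        rw [show r + n * q + 1 = (r + 1) + n * q by ring, Int.add_mul_emod_self_left,
          Int.emod_eq_of_lt (by omega) hlast]
      have e2 : (r + n * q + 1) / (n : ℤ) = q := by
        rw [show r + n * q + 1 = (r + 1) + n * q by ring, Int.add_mul_ediv_left _ _ hn'.ne',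
          Int.ediv_eq_zero_of_lt (by omega) hlast, zero_add]
      rw [e1, e2]
      gcongr
      unfold sortedAngle
      split_ifs with ha hb
      · push_cast
        gcongr
        linarith
      · have h2 : 0 ≤ (((r + 1 : ℤ) : ℝ) - (((n + 1) / 2 : ℕ) : ℝ)) / n := by
          apply div_nonneg _ hnr.le
          have : (((n + 1) / 2 : ℕ) : ℝ) ≤ ((r + 1 : ℤ) : ℝ) := by
            have h := (Int.cast_le (R := ℝ)).2 (not_lt.1 hb)
            rwa [Int.cast_natCast] at h
          linarith
        linarith [hlt1 h1]
      · omega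
      · gcongr
        linarith
    · have hr : r = n - 1 := by omega
      subst hr
      have e1 : ((n : ℤ) - 1 + n * q + 1) % (n : ℤ) = 0 := by
        rw [show (n : ℤ) - 1 + n * q + 1 = n * (q + 1) by ring, Int.mul_emod_right]
      have e2 : ((n : ℤ) - 1 + n * q + 1) / (n : ℤ) = q + 1 := by
        rw [show (n : ℤ) - 1 + n * q + 1 = n * (q + 1) by ring, Int.mul_ediv_cancel_left _ hn'.ne']
      have e3 : sortedAngle n 0 = 0 := by
        rw [sortedAngle, if_pos (by omega)]
        simp
      have e4 : sortedAngle n ((n : ℤ) - 1) < 2 * Real.pi := by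
        unfold sortedAngle
        split_ifs
        · linarith [hlt1 h1]
        · linarith [hlt1' h1]
      rw [e1, e2, e3]
      push_cast
      linarith
  angle_add m := by
    have hn' : (n : ℤ) ≠ 0 := by exact_mod_cast hn.ne'
    rw [Int.add_emod_right, Int.add_ediv_of_dvd_right (dvd_refl _), Int.ediv_self hn']
    push_cast
    ring

theorem standardRungs_angle (n : ℕ) (hn : 0 < n) {r : ℤ} (h0 : 0 ≤ r) (h1 : r < n) (q : ℤ) :
    (standardRungs n hn).angle (r + q * n) = sortedAngle n r + q * (2 * Real.pi) := by
  rw [RungSystem.angle_add_mul]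
  simp [standardRungs, Int.emod_eq_of_lt h0 h1, Int.ediv_eq_zero_of_lt h0 h1]

theorem rung_eq (n : ℕ) (k : Fin n) :
    rung n k = (fun τ => band (rungAngle n k) τ) '' Set.Icc (0 : ℝ) 1 := by
  rw [rung, segment_eq_image]
  refine Set.image_congr fun τ _ => ?_
  ext i
  fin_cases i <;> simp [side₁, side₂, band]
  ring

theorem standard_eq_ladder (n : ℕ) (hn : 0 < n) : standard n = (standardRungs n hn).ladder := by
  have hangle (k : Fin n) : rungAngle n k ∈ Set.range (standardRungs n hn).angle := by
    obtain ⟨k, hk⟩ := k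
    -- Even rungs `2j` are the first `(n + 1) / 2` in cyclic order and odd rungs `2j + 1` follow; `k
    -- * π` adds `j` full turns in either case.
    rcases Nat.even_or_odd' k with ⟨j, rfl | rfl⟩
    · refine ⟨(j : ℤ) + j * n, ?_⟩
      rw [standardRungs_angle n hn (by omega) (by omega), sortedAngle, if_pos (by omega), rungAngle]
      simp
      ring
    · refine ⟨((((n + 1) / 2 : ℕ) : ℤ) + j) + j * n, ?_⟩
      rw [standardRungs_angle n hn (by omega) (by omega), sortedAngle, if_neg (by omega), rungAngle]
      have : (2 * j + 1) / 2 = j := by omega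
      simp only [this]
      generalize (n + 1) / 2 = E
      push_cast
      ring
  ext x
  constructor
  · rintro ((⟨α, rfl⟩ | ⟨α, rfl⟩) | hx)
    · exact ⟨α, 0, by simp, by simp, (band_zero α).symm⟩
    · exact ⟨α, 1, by simp, by simp, (band_one α).symm⟩
    · obtain ⟨k, hk⟩ := Set.mem_iUnion.1 hx
      rw [rung_eq] at hk
      obtain ⟨τ, hτ, rfl⟩ := hk
      exact ⟨_, τ, hτ, Or.inr (Or.inr (hangle k)), rfl⟩
  · rintro ⟨α, τ, hτ, rfl | rfl | ⟨m, rfl⟩, rfl⟩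
    · exact Or.inl (Or.inl ⟨α, (band_zero α).symm⟩)
    · exact Or.inl (Or.inr ⟨α, (band_one α).symm⟩)
    · have hn' : (0 : ℤ) < n := by exact_mod_cast hn
      have h0 := Int.emod_nonneg m hn'.ne'
      have h1 := Int.emod_lt_of_pos m hn'
      have hdm := Int.emod_add_mul_ediv m n
      generalize m % (n : ℤ) = r at *
      generalize m / (n : ℤ) = q at *
      lift r to ℕ using h0
      refine Or.inr (Set.mem_iUnion.2 ?_)
      suffices ∃ (k : Fin n) (w : ℤ), (standardRungs n hn).angle m =
          rungAngle n k + w * (2 * Real.pi) by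
        obtain ⟨k, w, h⟩ := this
        refine ⟨k, ?_⟩
        rw [rung_eq, h, band_add_int_mul_two_pi]
        exact ⟨τ, hτ, rfl⟩
      rw [← hdm, mul_comm (n : ℤ) q, standardRungs_angle n hn (by omega) h1, sortedAngle]
      split_ifs with hlt
      · refine ⟨⟨2 * r, by omega⟩, q - r, ?_⟩
        simp [rungAngle]
        ring
      · obtain ⟨j, hj⟩ : ∃ j, r = (n + 1) / 2 + j := ⟨r - (n + 1) / 2, by omega⟩
        refine ⟨⟨2 * j + 1, by omega⟩, q - j, ?_⟩
        have : (2 * j + 1) / 2 = j := by omega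
        subst hj
        simp only [rungAngle, this]
        generalize (n + 1) / 2 = E
        push_cast
        ring

end HopfLadder

/-! ### Ambient isotopy -/

open TorusDegree in
theorem mirrorImage_eq (G : Set Space3) : mirrorImage G = mirror '' G := rfl

theorem TorusDegree.mirror_mirror (v : Space3) : mirror (mirror v) = v := by
  ext i
  fin_cases i <;> simp [mirror]

theorem TorusDegree.continuous_mirror : Continuous mirror := by
  refine (PiLp.continuous_toLp 2 _).comp (continuous_pi fun i => ?_)
  fin_cases i <;> simp <;> fun_prop

theorem TorusDegree.isHomeomorph_mirror : IsHomeomorph mirror :=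
  (Homeomorph.mk (Equiv.mk mirror mirror mirror_mirror mirror_mirror) continuous_mirror
    continuous_mirror).isHomeomorph

theorem TorusDegree.mirror_sub (v w : Space3) : mirror (v - w) = mirror v - mirror w := by
  ext i
  fin_cases i <;> simp [mirror]
  ring

open TorusDegree

theorem mirrorImage_mirrorImage (G : Set Space3) : mirrorImage (mirrorImage G) = G := by
  rw [mirrorImage_eq, mirrorImage_eq, Set.image_image]
  simp [mirror_mirror]

/-- The reverse isotopy is `F (1 - t) ∘ (F 1)⁻¹`; the inverse factor makes it start at the identity.
-/
theorem AmbientIsotopic.symm {G G' : Set Space3} (h : AmbientIsotopic G G') :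
    AmbientIsotopic G' G := by
  obtain ⟨F, hF, hh, h0, h1⟩ := h
  let e := (hh 1).homeomorph
  refine ⟨fun p => F (unitInterval.symm p.1, e.symm p.2), ?_, ?_, ?_, ?_⟩
  · have := e.symm.continuous
    fun_prop
  · intro t
    exact (hh (unitInterval.symm t)).comp e.symm.isHomeomorph
  · intro x
    simp only [unitInterval.symm_zero]
    exact e.apply_symm_apply x
  · simp only [unitInterval.symm_one, h0]
    rw [← h1]
    exact e.symm_image_image G

theorem AmbientIsotopic.trans {G G' G'' : Set Space3} (h : AmbientIsotopic G G')
    (h' : AmbientIsotopic G' G'') : AmbientIsotopic G G'' := by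
  obtain ⟨F, hF, hh, h0, h1⟩ := h
  obtain ⟨F', hF', hh', h0', h1'⟩ := h'
  let a : unitInterval → unitInterval := fun t => Set.projIcc 0 1 zero_le_one (2 * (t : ℝ))
  let b : unitInterval → unitInterval := fun t => Set.projIcc 0 1 zero_le_one (2 * (t : ℝ) - 1)
  have ha : Continuous a := continuous_projIcc.comp (by fun_prop)
  have hb : Continuous b := continuous_projIcc.comp (by fun_prop)
  have ha0 : a 0 = 0 := by simp [a]
  have ha1 : a 1 = 1 := Set.projIcc_of_right_le _ (by norm_num)
  have hb0 : b 0 = 0 := Set.projIcc_of_le_left _ (by norm_num)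
  have hb1 : b 1 = 1 := Set.projIcc_of_right_le _ (by norm_num)
  refine ⟨fun p => F' (b p.1, F (a p.1, p.2)), by fun_prop, fun t => (hh' (b t)).comp (hh (a t)),
    fun x => by simp only [ha0, hb0, h0, h0'], ?_⟩
  simp only [ha1, hb1]
  rw [← h1', ← h1, Set.image_image]

theorem AmbientIsotopic.mirrorImage {G G' : Set Space3} (h : AmbientIsotopic G G') :
    AmbientIsotopic (mirrorImage G) (mirrorImage G') := by
  obtain ⟨F, hF, hh, h0, h1⟩ := h
  have hm := continuous_mirror
  refine ⟨fun p => mirror (F (p.1, mirror p.2)), by fun_prop,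
    fun t => isHomeomorph_mirror.comp ((hh t).comp isHomeomorph_mirror), ?_, ?_⟩
  · intro x
    simp only [h0, mirror_mirror]
  · rw [mirrorImage_eq, mirrorImage_eq, ← h1, Set.image_image, Set.image_image]
    simp only [mirror_mirror]

/-- A Hopf ladder is achiral if and only if the standard one is. -/
theorem IsHopfLadder.isAchiral_iff {n : ℕ} {G : Set Space3} (h : IsHopfLadder n G) :
    IsAchiral G ↔ IsAchiral (HopfLadder.standard n) := by
  have key {A B : Set Space3} (hAB : AmbientIsotopic A B) (hA : IsAchiral A) : IsAchiral B :=
    (hAB.symm.trans hA).trans hAB.mirrorImage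
  have hmir (A : Set Space3) (hA : IsAchiral A) : IsAchiral (mirrorImage A) :=
    AmbientIsotopic.mirrorImage hA
  rcases h with h | h
  · exact ⟨key h.symm, key h⟩
  · refine ⟨fun hG => ?_, fun hs => key h (hmir _ hs)⟩
    have := hmir _ (key h.symm hG)
    rwa [mirrorImage_mirrorImage] at this

theorem AmbientIsotopic.refl (G : Set Space3) : AmbientIsotopic G G :=
  ⟨Prod.snd, continuous_snd, fun _ => (Homeomorph.refl Space3).isHomeomorph, fun _ => rfl,
    Set.image_id G⟩

/-! ### Achirality up to two rungs, chirality from three on. -/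

namespace HopfLadder

open Filter

theorem isAchiral_standard {n : ℕ} (hn : n ≤ 2) : IsAchiral (standard n) := by
  have hsub : mirrorImage (standard n) ⊆ standard n := by
    rw [mirrorImage_eq]
    rintro _ ⟨x, ((⟨α, rfl⟩ | ⟨α, rfl⟩) | hx), rfl⟩
    · refine Or.inl (Or.inl ⟨α, ?_⟩)
      simp [side₁, mirror]
    · refine Or.inl (Or.inr ⟨-α, ?_⟩)
      simp [side₂, mirror]
    · right
      obtain ⟨k, hk⟩ := Set.mem_iUnion.1 hx
      refine Set.mem_iUnion.2 ⟨k, ?_⟩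
      rw [rung_eq] at hk ⊢
      obtain ⟨τ, hτ, rfl⟩ := hk
      refine ⟨τ, hτ, ?_⟩
      -- For `k < 2` the offset vanishes, the angle is a multiple of `π`, and the rung lies on the
      -- `x`-axis.
      have hk2 : ((k : ℕ) / 2 : ℕ) = 0 := by omega
      have hsin : Real.sin (rungAngle n k) = 0 := by
        simp [rungAngle, hk2, Real.sin_nat_mul_pi]
      simp [band, mirror, hsin]
  have : mirrorImage (standard n) = standard n := by
    refine hsub.antisymm ?_
    have := Set.image_mono (f := mirror) hsub
    rw [← mirrorImage_eq, ← mirrorImage_eq, mirrorImage_mirrorImage] at this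
    exact this
  rw [IsAchiral, this]
  exact AmbientIsotopic.refl _

theorem isChiral_standard {n : ℕ} (hn : 3 ≤ n) : IsChiral (standard n) := by
  rintro ⟨F, hF, hh, h0, h1⟩
  have hn0 : 0 < n := by omega
  rw [standard_eq_ladder n hn0] at h1
  set R := standardRungs n hn0 with hR
  let f : Space3 → Space3 := fun x => mirror (F (1, x))
  have hfh : IsHomeomorph f := isHomeomorph_mirror.comp (hh 1)
  have hfX : f '' R.ladder = R.ladder := by
    have : f '' R.ladder = mirror '' ((fun x => F (1, x)) '' R.ladder) :=
      (Set.image_image _ _ _).symm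
    rw [this, h1, ← mirrorImage_eq, mirrorImage_mirrorImage]
  have hmaps : ∀ x ∈ R.ladder, f x ∈ R.ladder := fun x hx => hfX ▸ Set.mem_image_of_mem f hx
  let e := hfh.homeomorph
  have hmaps' : Set.MapsTo e.symm R.ladder R.ladder := by
    intro x hx
    rw [← hfX] at hx
    obtain ⟨y, hy, rfl⟩ := hx
    rwa [show e.symm (f y) = y from e.symm_apply_apply y]
  -- Being a branch point is a topological property, applied to `f` and to its inverse.
  have hV : ∀ x ∈ R.ladder, (f x ∈ R.vertices ↔ x ∈ R.vertices) := by
    intro x _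
    constructor
    · intro h
      have := (R.isBranchPoint_of_mem_vertices h).image e.symm.continuous e.symm.injective hmaps'
      rw [show e.symm (f x) = x from e.symm_apply_apply x] at this
      exact R.mem_vertices_of_isBranchPoint hn0 this
    · intro h
      exact R.mem_vertices_of_isBranchPoint hn0
        ((R.isBranchPoint_of_mem_vertices h).image hfh.continuous hfh.injective hmaps)
  have hlift (j : ℝ) (hj : j = 0 ∨ j = 1) : ∃ (α τ : ℝ → ℝ) (w : ℤ), Continuous α ∧ Continuous τ ∧
      (∀ s, τ s ∈ Set.Icc (0 : ℝ) 1) ∧ (∀ s, α (s + 2 * Real.pi) = α s + w * (2 * Real.pi)) ∧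
      (∀ s, τ (s + 2 * Real.pi) = τ s) ∧ ∀ s, f (band s j) = band (α s) (τ s) := by
    obtain ⟨α, τ, hα, hτ, hτI, h⟩ := exists_band_lift (c := fun s => f (band s j))
      (hfh.continuous.comp (continuous_band continuous_id continuous_const)) (fun s => by
        obtain ⟨a, b, hb, -, e⟩ := hmaps _
          ((R.band_mem_ladder (α := s) (RungSystem.mem_Icc_of_end hj)).2 (by tauto))
        exact ⟨a, b, hb, e⟩)
    obtain ⟨⟨w, hw⟩, hτp⟩ := exists_winding hα hτI (fun s => by
      rw [← h, ← h, show s + 2 * Real.pi = s + (1 : ℤ) * (2 * Real.pi) by simp,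
        band_add_int_mul_two_pi])
    exact ⟨α, τ, w, hα, hτ, hτI, hw, hτp, h⟩
  obtain ⟨α, τ, w, hα, hτ, hτI, hαp, hτp, hf⟩ := hlift 0 (Or.inl rfl)
  obtain ⟨α', τ', w', hα', hτ', hτI', hαp', hτp', hf'⟩ := hlift 1 (Or.inr rfl)
  have hne (s u : ℝ) : band (α s) (τ s) ≠ band (α' u) (τ' u) := by
    rw [← hf, ← hf', band_zero, band_one]
    exact fun h => side₁_ne_side₂ s u (hfh.injective h)
  have hp₁ (s : ℝ) : side₁ (s + 2 * Real.pi) = side₁ s := by simp [side₁]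
  have hp₂ (s : ℝ) : side₂ (s + 2 * Real.pi) = side₂ s := by simp [side₂]
  -- The sides remain disjoint during the isotopy, whose end is the reflection of their images under
  -- `f`.
  have hiso : TorusHomotopic (fun s u => side₁ s - side₂ u)
      (fun s u => mirror (band (α s) (τ s) - band (α' u) (τ' u))) := by
    refine ⟨fun t s u => F (Set.projIcc 0 1 zero_le_one t, side₁ s) -
      F (Set.projIcc 0 1 zero_le_one t, side₂ u), ?_, ?_, ?_, ?_, ?_, ?_⟩
    · have hs₁ := continuous_side₁
      have hs₂ := continuous_side₂
      have hpr : Continuous fun t : ℝ => Set.projIcc (0 : ℝ) 1 zero_le_one t := continuous_projIcc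
      exact (hF.comp ((hpr.comp continuous_fst).prodMk (by fun_prop))).sub
        (hF.comp ((hpr.comp continuous_fst).prodMk (by fun_prop)))
    · intro t _ s u
      exact sub_ne_zero.2 fun h => side₁_ne_side₂ s u ((hh _).injective h)
    · intro t s u
      simp only [hp₁]
    · intro t s u
      simp only [hp₂]
    · funext s u
      simp only [Set.projIcc_left]
      rw [show (⟨0, _⟩ : unitInterval) = 0 from rfl, h0, h0]
    · funext s u
      simp only [Set.projIcc_right]
      rw [mirror_sub, ← hf, ← hf', band_zero, band_one]
      simp only [f, mirror_mirror]
      rfl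
  have htorus : IsTorusMap fun s u => band (α s) (τ s) - band (α' u) (τ' u) :=
    isTorusMap_sub (continuous_band hα hτ) (continuous_band hα' hτ')
      (fun s => by rw [hαp, hτp, band_add_int_mul_two_pi])
      (fun s => by rw [hαp', hτp', band_add_int_mul_two_pi]) hne
  have hband := eventually_curvature_eq_of_band hα hτ hα' hτ' hτI hτI' hαp hαp' hτp hτp' hne
  have hcurv : ∀ᶠ N : ℕ in atTop, curvature N (fun s u => side₁ s - side₂ u) =
      -curvature N (fun s u => side₁ (w * s) - side₂ (w' * u)) := by
    filter_upwards [hiso.eventually_curvature_eq, htorus.eventually_curvature_mirror, hband]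
      with N e₁ e₂ e₃
    rw [e₁, e₂, e₃]
  -- If a winding vanishes, one loop is constant and unlinked; if both are `1` or both are `-1`, the
  -- curvature equals its own negative.
  have hzero : ∀ᶠ N : ℕ in atTop, curvature N (fun s u => side₁ s - side₂ u) = 0 := by
    rcases R.winding_eq hn hfh.continuous hfh.injective hmaps hV hα hτ hα' hτ' hτI hτI' hαp hαp' hf
      hf' with rfl | rfl | ⟨rfl, rfl | rfl⟩
    · filter_upwards [hcurv] with N hN
      rw [hN, curvature_eq_zero_of_const_fst (by simp), neg_zero]
    · filter_upwards [hcurv] with N hN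
      rw [hN, curvature_eq_zero_of_const_snd (by simp), neg_zero]
    · filter_upwards [hcurv] with N hN
      simp only [Int.cast_one, one_mul] at hN
      linarith
    · filter_upwards [hcurv, torusHomotopic_neg_neg.eventually_curvature_eq] with N hN hN'
      simp only [Int.cast_neg, Int.cast_one, neg_mul, one_mul] at hN
      linarith
  obtain ⟨N, h₁, h₂⟩ := (frequently_curvature_ne_zero.and_eventually hzero).exists
  exact h₁ h₂

end HopfLadder

theorem proposition1 (n : ℕ) (G : Set Space3) (hG : IsHopfLadder n G) :
    (n ≤ 2 → IsAchiral G) ∧ (3 ≤ n → IsChiral G) :=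
  ⟨fun hn => hG.isAchiral_iff.2 (HopfLadder.isAchiral_standard hn),
    fun hn h => HopfLadder.isChiral_standard hn (hG.isAchiral_iff.1 h)⟩
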